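/- **Conventions.** In a forcing notion the larger condition is the stronger one. For finite sequences, $\nu\trianglelefteq\eta$ ($\nu\vartriangleleft\eta$) means that $\nu$ is a (proper) initial segment of $\eta$. Let $\mathbf H$ be a function on $\omega$ with $|\mathbf H(m)|\ge 2$ for all $m$, and $\mathrm{Seq}=\bigcup_{n}\prod_{i<n}\mathbf H(i)$. A *quasi tree* is a set $T$ of finite sequences with a $\trianglelefteq$-smallest element $\mathrm{root}(T)$; $\mathrm{succ}_T(\eta)$ is the set of minimal proper extensions of $\eta$ in $T$, $\max(T)$ the set of maximal elements, $\hat T=T\setminus\max(T)$, $\lim(T)$ the set of $\omega$-sequences $x$ with $x{\restriction}n\in T$ for infinitely many $n$; $T$ is *well founded* if $\lim(T)=\emptyset$. A *front* of $T$ is a $\vartriangleleft$-antichain $F\subseteq T$ such that every $x\in\lim(T)\cup\max(T)$ has an initial segment in $F$. A *weak creature* is a triple $t=(\mathbf{nor}[t],\mathbf{val}[t],\mathbf{dis}[t])$ with $\mathbf{nor}[t]\in[0,\infty)$, $\mathbf{val}[t]$ a non-empty set of pairs $\langle u,v\rangle$ from $\mathrm{Seq}$ with $u\vartriangleleft v$,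 and $\mathbf{dis}[t]$ an arbitrary parameter. It is a *tree-creature at* $\eta$ if $\mathrm{dom}(\mathbf{val}[t])=\{\eta\}$ and $\mathrm{pos}(t):=\mathrm{rng}(\mathbf{val}[t])$ is a $\vartriangleleft$-antichain. Let $K$ be a set of tree-creatures. A *system* is $\langle s_\nu:\nu\in\hat T\rangle\subseteq K$ where $T\subseteq\mathrm{Seq}$ is a well founded quasi tree, $s_\nu$ is a tree-creature at $\nu$ and $\mathrm{pos}(s_\nu)=\mathrm{succ}_T(\nu)$. The pair $(K,\Sigma)$ is a *tree-creating pair* for $\mathbf H$ if $\Sigma:[K]^{\le\omega}\to\mathcal P(K)$ satisfies: $\Sigma(\emptyset)=\emptyset$; $t\in\Sigma(t):=\Sigma(\{t\})$ for $t\in K$; if $s\in\Sigma(S_s)$ for all $s\in S$ then $\Sigma(S)\subseteq\Sigma(\bigcup_{s\in S}S_s)$; if $\Sigma(S)\ne\emptyset$ then $S$ is the set of members of a system; and every $t\in\Sigma(s_\nu:\nu\in\hat T)$ is a tree-creature at $\mathrm{root}(T)$ with $\mathrm{pos}(t)\subseteq\max(T)$. A tree-creating pair is * *strongly finitary* if all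 $\mathbf H(n)$, all $\mathbf{val}[t]$ ($t\in K$) and all $\Sigma(S)$ are finite; * *2-big* if for all $t\in K$ with $\mathbf{nor}[t]>1$ and $h:\mathrm{pos}(t)\to 2$ there is $s\in\Sigma(t)$ with $h{\restriction}\mathrm{pos}(s)$ constant and $\mathbf{nor}[s]\ge\mathbf{nor}[t]-1$; * *t-omittory* if for every system and $\nu_0\in\hat T$ with $\mathrm{pos}(s_{\nu_0})\subseteq\max(T)$ there is $s\in\Sigma(s_\nu:\nu\in\hat T)$ with $\mathbf{nor}[s]\ge\mathbf{nor}[s_{\nu_0}]-1$ and $\mathrm{pos}(s)\subseteq\mathrm{pos}(s_{\nu_0})$; * *gluing* if for every system with $\hat T\neq\emptyset$ there is $s\in\Sigma(s_\nu:\nu\in\hat T)$ with $\mathbf{nor}[s]\ge\sup\{\mathbf{nor}[s_\nu]-1:\nu\in\hat T\}$; * *of the NNP-type* if there are strictly increasing sequences $\langle a_n\rangle\subseteq(0,1)$ and $\langle k_n\rangle\subseteq\omega$ with $\lim a_n<1$ such that, whenever $t\in K$ is a tree-creature at $v$, $\mathbf{nor}[t]>2$, $\mathrm{lh}(v)\ge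 k_n$, $N\in\omega$ and $g:\mathrm{pos}(t)\to\mathcal P(N)$ satisfies $a_{n+1}\le|g(u)|/N$ for all $u$, the set of those $i<N$ for which there is $s\in\Sigma(t)$ with $\mathbf{nor}[s]\ge\mathbf{nor}[t]-1$ and $i\in g(u)$ for all $u\in\mathrm{pos}(s)$ has at least $N\cdot a_n$ elements; * *strongly violating the Sacks property* if for some non-decreasing unbounded $f:\omega\to\omega$: for all $t\in K$ at $u$ with $\mathbf{nor}[t]>1$ there is $n\ge\mathrm{lh}(u)$ with $f(n)<|\{w(n):w\in\mathrm{pos}(t),\ n<\mathrm{lh}(w)\}|$. For $e<5$, conditions of $\mathbb Q^{\rm tree}_e(K,\Sigma)$ are sequences $\langle t_\eta:\eta\in T\rangle$, where $T\subseteq\mathrm{Seq}$ is a quasi tree with $\max(T)=\emptyset$, $t_\eta\in K$ is a tree-creature at $\eta$ with $\mathrm{pos}(t_\eta)=\mathrm{succ}_T(\eta)$, and the following holds. ($e=0$) For all $x\in\lim(T)$ the numbers $\mathbf{nor}[t_{x\restriction k}]$ ($x{\restriction}k\in T$) have $\limsup=\infty$. ($e=1$) For all $x\in\lim(T)$ these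 numbers tend to $\infty$. ($e=2$) For all $\eta\in T$, $n<\omega$ there is $\nu\in T$ with $\eta\vartriangleleft\nu$ and $\mathbf{nor}[t_\nu]\ge n$. ($e=3$) For all $\eta\in T$, $n<\omega$ there is $\nu\in T$ with $\eta\vartriangleleft\nu$ such that $\mathbf{nor}[t_\rho]\ge n$ for all $\rho\in T$ with $\nu\vartriangleleft\rho$. ($e=4$) For all $n$, the set $\{\nu\in T:(\forall\rho\in T)(\nu\vartriangleleft\rho\Rightarrow\mathbf{nor}[t_\rho]\ge n)\}$ contains a front of $T$. The order is: $\langle t^1_\eta:\eta\in T^1\rangle\le\langle t^2_\eta:\eta\in T^2\rangle$ iff $T^2\subseteq T^1$ and for every $\eta\in T^2$ there is a well founded quasi tree $T_0\subseteq\{\nu\in T^1:\eta\trianglelefteq\nu\}$ such that $\langle t^1_\nu:\nu\in\hat T_0\rangle$ is a system and $t^2_\eta\in\Sigma(t^1_\nu:\nu\in\hat T_0)$. **Theorem.** There are a function $\mathbf H$, with each $\mathbf H(n)$ a finite set of natural numbers of size at least $2$, and a tree-creating pair $(K,\Sigma)$ for $\mathbf H$ which is strongly finitary, 2-big, t-omittory,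 gluing, of the NNP-type and strongly violates the Sacks property, such that: 1. $\mathbb Q^{\rm tree}_e(K,\Sigma)$, $e<5$, are forcing notions (their orders are reflexive and transitive), and they are pairwise forcing equivalent, i.e. any two of them have dense embeddings into a common partial order; 2. each of them is proper; 3. each is $\omega^\omega$-bounding: every $x\in\omega^\omega$ in a generic extension is eventually strictly dominated by some $y\in\omega^\omega$ of the ground model; 4. each preserves outer measure: for every ground model $A\subseteq 2^\omega$ the outer measure of $A$ in any generic extension equals its outer measure in the ground model; 5. each preserves non-meager sets: every non-meager $A\subseteq2^\omega$ of the ground model is non-meager in every generic extension; 6. none of them has the Sacks property, where $\mathbb P$ has the Sacks property if for every $x\in\omega^\omega$ in a generic extension by $\mathbb P$ there is, in the ground model, a sequence $F$ of subsets of $\omega$ with $|F(n)|=n+1$ and $x(n)\in F(n)$ for all $n$. -/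

import Mathlib

open Set Filter Topology MeasureTheory
open scoped NNReal ENNReal

namespace Creature

/-! ### Forcing notions

A forcing notion is a type `P` with a (reflexive and transitive) relation `≤`;
the LARGER condition is the STRONGER one. -/

section Forcing

variable {P : Type} [LE P]

/-- Two conditions are compatible if they have a common extension. -/
def Compat (p q : P) : Prop := ∃ r, p ≤ r ∧ q ≤ r

/-- Dense subsets of a forcing notion. -/
def IsDense (D : Set P) : Prop := ∀ p : P, ∃ d ∈ D, p ≤ d

/-- A statement of the forcing language, given by the set of conditions that force it. -/
abbrev FProp (P : Type) : Type := P → Prop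

/-- A name for a subset of the ground model set `I`: the pair `(i, p)` belongs to the name
iff `p ∈ X i`.  Every subset of `I` in a generic extension has a name of this form. -/
abbrev Name (P : Type) (I : Type) : Type := I → Set P

/-- A statement about the ground model. -/
def fGround (φ : Prop) : FProp P := fun _ => φ

/-- `p ⊩ i ∈ X` iff the conditions lying above some member of `X i` are dense above `p`. -/
def fMem {I : Type} (i : I) (X : Name P I) : FProp P :=
  fun p => ∀ q, p ≤ q → ∃ r, q ≤ r ∧ ∃ s ∈ X i, s ≤ r

def fAnd (φ ψ : FProp P) : FProp P := fun p => φ p ∧ ψ p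

def fNot (φ : FProp P) : FProp P := fun p => ∀ q, p ≤ q → ¬ φ q

def fImp (φ ψ : FProp P) : FProp P := fun p => ∀ q, p ≤ q → φ q → ψ q

/-- Universal quantifier, over a ground model set or over names. -/
def fAll {ι : Type} (φ : ι → FProp P) : FProp P := fun p => ∀ i, φ i p

/-- Existential quantifier, over a ground model set or over names. -/
def fEx {ι : Type} (φ : ι → FProp P) : FProp P :=
  fun p => ∀ q, p ≤ q → ∃ r, q ≤ r ∧ ∃ i, φ i r

/-- `φ` is forced by every condition. -/
def Forced (φ : FProp P) : Prop := ∀ p, φ p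

/-- A name for a subset of `ℕ × ℕ` is (the graph of) a function from `ℕ` to `ℕ`. -/
def fIsFun (x : Name P (ℕ × ℕ)) : FProp P :=
  fAnd (fAll fun n : ℕ => fEx fun m : ℕ => fMem (n, m) x)
    (fAll fun n : ℕ => fAll fun m : ℕ => fAll fun m' : ℕ =>
      fImp (fAnd (fMem (n, m) x) (fMem (n, m') x)) (fGround (m = m')))

variable (P)

/-- Every real of the extension in Baire space is eventually strictly below a ground model
one. -/
def BaireBounding : Prop :=
  ∀ x : Name P (ℕ × ℕ), Forced (fImp (fIsFun x)
    (fEx fun y : ℕ → ℕ => fEx fun k : ℕ => fAll fun n : ℕ => fImp (fGround (k < n))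
      (fAll fun m : ℕ => fImp (fMem (n, m) x) (fGround (m < y n)))))

/-- Every real `x` of the extension in Baire space is captured by a ground model sequence `F`
with `F n` a set of size `n + 1`. -/
def SacksProperty : Prop :=
  ∀ x : Name P (ℕ × ℕ), Forced (fImp (fIsFun x)
    (fEx fun F : {F : ℕ → Finset ℕ // ∀ n, (F n).card = n + 1} =>
      fAll fun n : ℕ => fAll fun m : ℕ => fImp (fMem (n, m) x) (fGround (m ∈ F.1 n))))

/-- `C` is a club in the family of countable subsets of `X`. -/
def IsClub {X : Type} (C : Set (Set X)) : Prop :=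
  (∀ a ∈ C, a.Countable) ∧
  (∀ a : Set X, a.Countable → ∃ b ∈ C, a ⊆ b) ∧
  (∀ c : ℕ → Set X, Monotone c → (∀ n, c n ∈ C) → (⋃ n, c n) ∈ C)

variable {P} in
/-- `q` is an `(N, P)`-generic condition, for a set `N` of conditions and subsets of `P`:
for every dense set `D` in `N`, the set `D ∩ N` is predense above `q`. -/
def IsGenericCondition (N : Set (P ⊕ Set P)) (q : P) : Prop :=
  ∀ D : Set P, IsDense D → Sum.inr D ∈ N →
    ∀ r, q ≤ r → ∃ d ∈ D, Sum.inl d ∈ N ∧ Compat d r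

/-- Properness: for club many countable `N`, every condition in `N` has an extension that is
`(N, P)`-generic.  Genericity over `N` only depends on the conditions and the dense sets in `N`,
so that the traces of countable elementary submodels on the disjoint union of `P` and its power
set are the relevant objects. -/
def IsProper : Prop :=
  ∃ C : Set (Set (P ⊕ Set P)), IsClub C ∧
    ∀ N ∈ C, ∀ p : P, Sum.inl p ∈ N → ∃ q, p ≤ q ∧ IsGenericCondition N q

end Forcing

/-- A dense embedding: it preserves the order and incompatibility and has dense range. -/
def IsDenseEmbedding {P R : Type} [LE P] [LE R] (i : P → R) : Prop :=
  (∀ p q, p ≤ q → i p ≤ i q) ∧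
  (∀ p q, ¬ Compat p q → ¬ Compat (i p) (i q)) ∧
  (∀ r, ∃ p, r ≤ i p)

/-- Two forcing notions are equivalent if both embed densely into one partial order
(equivalently, if their Boolean completions are isomorphic). -/
def ForcingEquivalent (P Q : Type) [LE P] [LE Q] : Prop :=
  ∃ (R : Type) (_ : PartialOrder R) (i : P → R) (j : Q → R),
    IsDenseEmbedding i ∧ IsDenseEmbedding j

/-! ### Measure and category on the Cantor space -/

/-- The restriction of an infinite sequence to its first `n` terms. -/
def restr {A : Type} (x : ℕ → A) (n : ℕ) : List A := (List.range n).map x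

/-- The product (Haar, "Lebesgue") measure on the Cantor space; its value at an arbitrary set
is the outer measure of that set. -/
noncomputable def cantorMeasure : Measure (ℕ → Bool) :=
  Measure.infinitePi fun _ : ℕ => (PMF.uniformOfFintype Bool).toMeasure

section Preservation

variable {P : Type} [LE P]

/-- "In the extension, the set `A` (of ground model points of the Cantor space) is covered by
basic clopen sets whose measures add up to at most `r`." -/
noncomputable def fOuterLE (A : Set (ℕ → Bool)) (r : ℝ≥0) : FProp P :=
  fEx fun C : Name P (List Bool) =>
    fAnd (fAll fun x : A => fEx fun k : ℕ => fMem (restr x.1 k) C)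
      (fAll fun F : Finset (List Bool) =>
        fImp (fAll fun s : F => fMem s.1 C)
          (fGround (∑ s ∈ F, (1 / 2 : ℝ≥0) ^ s.length ≤ r)))

/-- "In the extension, the set `A` (of ground model points of the Cantor space) is meager":
there are sets `S n` of finite binary sequences such that every closed set
`{y | ∀ k, y restricted to k is in S n}` is nowhere dense, as witnessed by the fact that every
finite sequence has an extension outside `S n`, and these closed sets cover `A`. -/
def fMeager (A : Set (ℕ → Bool)) : FProp P :=
  fEx fun S : Name P (ℕ × List Bool) =>
    fAnd (fAll fun n : ℕ => fAll fun s : List Bool => fEx fun u : List Bool =>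
        fAnd (fGround (s <+: u)) (fNot (fMem (n, u) S)))
      (fAll fun x : A => fEx fun n : ℕ => fAll fun k : ℕ => fMem (n, restr x.1 k) S)

variable (P)

/-- For every `A`, it is forced that the outer measure of `A` in the extension is equal to
the outer measure of `A` in the ground model. -/
def PreservesOuterMeasure : Prop :=
  ∀ (A : Set (ℕ → Bool)) (r : ℝ≥0),
    (cantorMeasure A < (r : ℝ≥0∞) → Forced (P := P) (fOuterLE A r)) ∧
    ((r : ℝ≥0∞) < cantorMeasure A → Forced (P := P) (fNot (fOuterLE A r)))

/-- Non-meager sets of the ground model are forced to remain non-meager. -/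
def PreservesNonMeager : Prop :=
  ∀ A : Set (ℕ → Bool), ¬ IsMeagre A → Forced (P := P) (fNot (fMeager A))

end Preservation

/-! ### Quasi trees -/

section Trees

variable {A : Type}

/-- `s` is a proper initial segment of `u`. -/
def PInit (s u : List A) : Prop := s <+: u ∧ s ≠ u

/-- The finite sequences `s` with `s i ∈ H i` for all `i < length s`. -/
def FinSeq (H : ℕ → Set A) : Set (List A) :=
  {s | ∀ (i : ℕ) (hi : i < s.length), s[i] ∈ H i}

/-- `r` is the smallest element of `T`. -/
def IsRoot (T : Set (List A)) (r : List A) : Prop := r ∈ T ∧ ∀ s ∈ T, r <+: s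

def IsQuasiTree (T : Set (List A)) : Prop := ∃ r, IsRoot T r

/-- The (not necessarily immediate) successors of `s` in `T`. -/
def suc (T : Set (List A)) (s : List A) : Set (List A) :=
  {u ∈ T | PInit s u ∧ ¬ ∃ v ∈ T, PInit s v ∧ PInit v u}

/-- The maximal points of `T`. -/
def maxPts (T : Set (List A)) : Set (List A) := {s ∈ T | ¬ ∃ u ∈ T, PInit s u}

/-- The non-maximal points of `T`. -/
def hat (T : Set (List A)) : Set (List A) := T \ maxPts T

/-- The infinite branches through `T`. -/
def lim (T : Set (List A)) : Set (ℕ → A) := {x | ∀ m, ∃ n, m < n ∧ restr x n ∈ T}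

/-- `F` is a front of `T`. -/
def IsFront (T F : Set (List A)) : Prop :=
  F ⊆ T ∧ (∀ s ∈ F, ∀ u ∈ F, ¬ PInit s u) ∧
  (∀ x ∈ lim T, ∃ n, restr x n ∈ F) ∧ (∀ s ∈ maxPts T, ∃ n, s.take n ∈ F)

end Trees

/-! ### Weak creatures and tree-creating pairs -/

/-- The data of a weak creature: the norm, the relation `val` and a distinguishing parameter,
taken from some set `D`. -/
structure WeakCreature (A D : Type) where
  nor : ℝ
  val : Set (List A × List A)
  dis : D

section Creatures

variable {A D : Type}

/-- `t` is a weak creature for `H`. -/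
def IsWeakCreature (H : ℕ → Set A) (t : WeakCreature A D) : Prop :=
  0 ≤ t.nor ∧ t.val.Nonempty ∧
    ∀ z ∈ t.val, z.1 ∈ FinSeq H ∧ z.2 ∈ FinSeq H ∧ PInit z.1 z.2

/-- The range of the relation `val`. -/
def WeakCreature.rng (t : WeakCreature A D) : Set (List A) := {u | ∃ w, (w, u) ∈ t.val}

/-- `t` is a tree-creature for `H` and the domain of its relation `val` is `{s}`. -/
def IsTreeCreatureAt (H : ℕ → Set A) (s : List A) (t : WeakCreature A D) : Prop :=
  IsWeakCreature H t ∧ (∀ z ∈ t.val, z.1 = s) ∧ ∀ u ∈ t.rng, ∀ v ∈ t.rng, ¬ PInit u v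

/-- `Sig` is a sub-composition operation on `K`.  Only the values of `Sig` at
countable subsets of `K` are relevant. -/
structure IsWeakCreatingPair (H : ℕ → Set A) (K : Set (WeakCreature A D))
    (Sig : Set (WeakCreature A D) → Set (WeakCreature A D)) : Prop where
  weakCreature : ∀ t ∈ K, IsWeakCreature H t
  sig_subset : ∀ S ⊆ K, S.Countable → Sig S ⊆ K
  transitivity : ∀ S ⊆ K, S.Countable →
    ∀ B : WeakCreature A D → Set (WeakCreature A D),
      (∀ s ∈ S, B s ⊆ K ∧ (B s).Countable ∧ s ∈ Sig (B s)) → Sig S ⊆ Sig (⋃ s ∈ S, B s)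
  self_mem : ∀ t ∈ K, t ∈ Sig {t}
  sig_empty : Sig ∅ = ∅

/-- `T` is a well founded quasi tree of sequences from `H` and `s` assigns to each non-maximal
point of `T` a tree-creature in `K` that describes the passage to the successors in `T`. -/
structure IsSystem (H : ℕ → Set A) (K : Set (WeakCreature A D)) (T : Set (List A))
    (s : List A → WeakCreature A D) : Prop where
  subset : T ⊆ FinSeq H
  quasiTree : IsQuasiTree T
  wellFounded : lim T = ∅
  mem : ∀ v ∈ hat T, s v ∈ K
  treeCreature : ∀ v ∈ hat T, IsTreeCreatureAt H v (s v)
  rng_eq : ∀ v ∈ hat T, (s v).rng = suc T v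

/-- `(K, Sig)` is a tree-creating pair for `H`. -/
structure IsTreeCreatingPair (H : ℕ → Set A) (K : Set (WeakCreature A D))
    (Sig : Set (WeakCreature A D) → Set (WeakCreature A D)) : Prop
    extends IsWeakCreatingPair H K Sig where
  two_le : ∀ n, (H n).Nontrivial
  treeCreature : ∀ t ∈ K, ∃ v, IsTreeCreatureAt H v t
  system_of_nonempty : ∀ S ⊆ K, S.Countable → (Sig S).Nonempty →
    ∃ (T : Set (List A)) (s : List A → WeakCreature A D), IsSystem H K T s ∧ S = s '' hat T
  mem_sig : ∀ (T : Set (List A)) (s : List A → WeakCreature A D), IsSystem H K T s →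
    ∀ t ∈ Sig (s '' hat T),
      (∃ r, IsRoot T r ∧ IsTreeCreatureAt H r t) ∧ t.rng ⊆ maxPts T

/-- The basis of a weak creature. -/
def basis (H : ℕ → Set A) (Sig : Set (WeakCreature A D) → Set (WeakCreature A D))
    (t : WeakCreature A D) : Set (List A) :=
  {w ∈ FinSeq H | ∃ s ∈ Sig {t}, ∃ u, (w, u) ∈ s.val}

/-- The possible extensions of `w` from the point of view of the creature `t`.  For a
tree-creating pair and `w` in the basis of `t` this is the range of the relation `val` of `t`. -/
def pos (Sig : Set (WeakCreature A D) → Set (WeakCreature A D)) (w : List A)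
    (t : WeakCreature A D) : Set (List A) :=
  {u | ∃ s ∈ Sig {t}, (w, u) ∈ s.val}

/-- Strongly finitary pairs. -/
def StronglyFinitary (H : ℕ → Set A) (K : Set (WeakCreature A D))
    (Sig : Set (WeakCreature A D) → Set (WeakCreature A D)) : Prop :=
  (∀ n, (H n).Finite) ∧ (∀ t ∈ K, t.val.Finite) ∧ ∀ S ⊆ K, S.Countable → (Sig S).Finite

/-- `k`-big tree-creating pairs. -/
def IsBig (k : ℕ) (K : Set (WeakCreature A D))
    (Sig : Set (WeakCreature A D) → Set (WeakCreature A D)) : Prop :=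
  ∀ t ∈ K, 1 < t.nor → ∀ h : List A → Fin k,
    ∃ s ∈ Sig {t}, (∀ u ∈ s.rng, ∀ v ∈ s.rng, h u = h v) ∧ t.nor - 1 ≤ s.nor

/-- t-omittory tree-creating pairs. -/
def TOmittory (H : ℕ → Set A) (K : Set (WeakCreature A D))
    (Sig : Set (WeakCreature A D) → Set (WeakCreature A D)) : Prop :=
  ∀ (T : Set (List A)) (s : List A → WeakCreature A D), IsSystem H K T s →
    ∀ v ∈ hat T, (s v).rng ⊆ maxPts T →
      ∃ t ∈ Sig (s '' hat T), (s v).nor - 1 ≤ t.nor ∧ t.rng ⊆ (s v).rng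

/-- Gluing tree-creating pairs: the norm of the glued creature is at least the supremum of
the numbers `(s v).nor - 1`. -/
def Gluing (H : ℕ → Set A) (K : Set (WeakCreature A D))
    (Sig : Set (WeakCreature A D) → Set (WeakCreature A D)) : Prop :=
  ∀ (T : Set (List A)) (s : List A → WeakCreature A D), IsSystem H K T s → (hat T).Nonempty →
    ∃ t ∈ Sig (s '' hat T), ∀ v ∈ hat T, (s v).nor - 1 ≤ t.nor

/-- Weak creating pairs of the NNP-type. -/
def NNPType (H : ℕ → Set A) (K : Set (WeakCreature A D))
    (Sig : Set (WeakCreature A D) → Set (WeakCreature A D)) : Prop :=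
  ∃ (a : ℕ → ℝ) (k : ℕ → ℕ), StrictMono a ∧ StrictMono k ∧ (∀ n, a n ∈ Ioo (0 : ℝ) 1) ∧
    (∃ l < (1 : ℝ), Tendsto a atTop (𝓝 l)) ∧
    ∀ n, ∀ t ∈ K, 2 < t.nor → ∀ v ∈ basis H Sig t, k n ≤ v.length →
      ∀ (N : ℕ) (g : List A → Finset ℕ),
        (∀ u ∈ pos Sig v t, g u ⊆ Finset.range N ∧ a (n + 1) ≤ ((g u).card : ℝ) / N) →
        (N : ℝ) * a n ≤ ({i : ℕ | i < N ∧ ∃ s ∈ Sig {t}, t.nor - 1 ≤ s.nor ∧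
          basis H Sig t ⊆ basis H Sig s ∧ ∀ u ∈ pos Sig v s, i ∈ g u}.ncard : ℝ)

/-- Weak creating pairs strongly violating the Sacks property. -/
def StronglyViolatesSacks (H : ℕ → Set A) (K : Set (WeakCreature A D))
    (Sig : Set (WeakCreature A D) → Set (WeakCreature A D)) : Prop :=
  ∃ f : ℕ → ℕ, Monotone f ∧ (∀ m, ∃ n, m < f n) ∧
    ∀ t ∈ K, 1 < t.nor → ∀ u ∈ basis H Sig t, ∃ n, u.length ≤ n ∧
      (f n : ℕ∞) < {x : A | ∃ w ∈ pos Sig u t, ∃ hn : n < w.length, w[n] = x}.encard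

/-- The five norm conditions on a system `⟨t v : v ∈ T⟩` of creatures. -/
def NormCondition (T : Set (List A)) (t : List A → WeakCreature A D) : Fin 5 → Prop
  | 0 => ∀ x ∈ lim T, ∀ b : ℝ, ∀ m : ℕ, ∃ k, m ≤ k ∧ restr x k ∈ T ∧ b ≤ (t (restr x k)).nor
  | 1 => ∀ x ∈ lim T, ∀ b : ℝ, ∃ m : ℕ, ∀ k, m ≤ k → restr x k ∈ T → b ≤ (t (restr x k)).nor
  | 2 => ∀ s ∈ T, ∀ n : ℕ, ∃ v ∈ T, PInit s v ∧ (n : ℝ) ≤ (t v).nor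
  | 3 => ∀ s ∈ T, ∀ n : ℕ, ∃ v ∈ T, PInit s v ∧ ∀ u ∈ T, PInit v u → (n : ℝ) ≤ (t u).nor
  | 4 => ∀ n : ℕ, ∃ F, IsFront T F ∧ ∀ v ∈ F, ∀ u ∈ T, PInit v u → (n : ℝ) ≤ (t u).nor

/-- Conditions `⟨t v : v ∈ T⟩` of the forcing notion determined by the pair `(K, Sig)` and the
norm condition number `e`.  The values of `t` off `T` are irrelevant. -/
structure TreeForcing (H : ℕ → Set A) (K : Set (WeakCreature A D))
    (Sig : Set (WeakCreature A D) → Set (WeakCreature A D)) (e : Fin 5) where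
  T : Set (List A)
  t : List A → WeakCreature A D
  subset : T ⊆ FinSeq H
  quasiTree : IsQuasiTree T
  no_max : maxPts T = ∅
  mem : ∀ v ∈ T, t v ∈ K
  treeCreature : ∀ v ∈ T, IsTreeCreatureAt H v (t v)
  rng_eq : ∀ v ∈ T, (t v).rng = suc T v
  norm : NormCondition T t e

/-- `p ≤ q`, that is, `q` is stronger than `p`, iff the quasi tree of `q` is contained in that
of `p` and each creature of `q` is obtained from creatures of `p` that are placed along a
well founded quasi tree. -/
instance (H : ℕ → Set A) (K : Set (WeakCreature A D))
    (Sig : Set (WeakCreature A D) → Set (WeakCreature A D)) (e : Fin 5) :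
    LE (TreeForcing H K Sig e) where
  le p q := q.T ⊆ p.T ∧ ∀ v ∈ q.T, ∃ T₀ : Set (List A),
    (∀ u ∈ T₀, u ∈ p.T ∧ v <+: u) ∧ IsSystem H K T₀ p.t ∧ q.t v ∈ Sig (p.t '' hat T₀)

end Creatures

end Creature

/-! The creatures are chosen so that composition is unrestricted. A creature is any finite nonempty
antichain of proper extensions of a point, and `fullSig` lets a system compose to every creature of
`K` at its root whose range consists of maximal points. Hence the order of each forcing is just
reverse inclusion of quasi trees (`TreeForcing.le_iff`), and transitivity of the composition is
substitution of systems into systems (`IsSystem.bind`).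

The norm is a logarithm, to the base `growth m = 2 ^ (m + 3)`, of the number of values taken at a
single place `m`. Three features carry the theorem. Values at one place survive when sequences are
extended; this gives gluing, and it allows successors to be replaced by roots of stronger
conditions. Keeping at least the fraction `1 / growth m` of the values costs only one unit of the
norm; this gives bigness. Finally, the places lie above the lengths of the points concerned, so that
averaging arguments lose terms `1 / growth m` that are summable along a branch; this gives the
NNP-type and the preservation of outer measure. Since also `growth m > m`, a splitting takes too
many values at place `m` for the Sacks property.

All forcing arguments go through `fusion`. Starting from a condition, each condition `r` of level
`n` receives a finite family of stronger conditions whose roots take `growth m ^ n` values at some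
place `m` (`IsSplit`). The set of all roots that arise is the quasi tree of a condition `q`, and
every extension of `q` is compatible with a member of each level. The norms of `q` satisfy the
strongest of the five norm conditions, number `4`, whereas every condition satisfies the weakest,
number `2`. This yields the equivalence of the five forcings.

For properness the families are taken inside dense sets from the countable set `N`; for bounding
they decide one value per level. For non-meager sets, all members of a family exclude initial
segments of a common finite sequence, and a point of `A` that is generic for countably many dense
open sets guides the fusion. For outer measure, a fusion tree is fixed in advance; the points for
which it cannot be pruned so as to avoid the small cover have measure below the outer measure of
`A`, so some point of `A` escapes and the pruned tree contradicts the cover. -/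

namespace Creature

/-! ### Initial segments -/

section Lists

variable {A : Type}

theorem PInit.length_lt {s u : List A} (h : PInit s u) : s.length < u.length :=
  lt_of_le_of_ne h.1.length_le fun e => h.2 (h.1.eq_of_length e)

theorem PInit.of_length_lt {s u : List A} (h : s <+: u) (hl : s.length < u.length) :
    PInit s u := ⟨h, fun e => by simp [e] at hl⟩

theorem pInit_irrefl (s : List A) : ¬ PInit s s := fun h => h.2 rfl

theorem PInit.trans_prefix {s u v : List A} (h : PInit s u) (h' : u <+: v) : PInit s v :=
  .of_length_lt (h.1.trans h') (h.length_lt.trans_le h'.length_le)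

theorem PInit.prefix_trans {s u v : List A} (h : s <+: u) (h' : PInit u v) : PInit s v :=
  .of_length_lt (h.trans h'.1) (h.length_le.trans_lt h'.length_lt)

theorem PInit.trans {s u v : List A} (h : PInit s u) (h' : PInit u v) : PInit s v :=
  h.trans_prefix h'.1

theorem prefix_antisymm {s u : List A} (h : s <+: u) (h' : u <+: s) : s = u :=
  h.eq_of_length (le_antisymm h.length_le h'.length_le)

theorem prefix_or_pInit {s u v : List A} (h : s <+: v) (h' : u <+: v) : s <+: u ∨ PInit u s := by
  rcases le_or_gt s.length u.length with hl | hl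
  · exact .inl (List.prefix_of_prefix_length_le h h' hl)
  · exact .inr (.of_length_lt (List.prefix_of_prefix_length_le h' h hl.le) hl)

theorem eq_or_pInit {s u : List A} (h : s <+: u) : s = u ∨ PInit s u := by
  by_cases e : s = u
  · exact .inl e
  · exact .inr ⟨h, e⟩

@[simp] theorem length_restr (x : ℕ → A) (n : ℕ) : (restr x n).length = n := by simp [restr]

theorem getElem_restr (x : ℕ → A) (n i : ℕ) (h : i < (restr x n).length) :
    (restr x n)[i] = x i := by simp [restr]

theorem restr_prefix (x : ℕ → A) {m n : ℕ} (h : m ≤ n) : restr x m <+: restr x n := by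
  obtain ⟨k, rfl⟩ := Nat.exists_eq_add_of_le h
  simp [restr, List.range_add]

theorem restr_pInit (x : ℕ → A) {m n : ℕ} (h : m < n) : PInit (restr x m) (restr x n) :=
  .of_length_lt (restr_prefix x h.le) (by simpa)

theorem eq_restr_of_prefix {x : ℕ → A} {n : ℕ} {s : List A} (h : s <+: restr x n) :
    s = restr x s.length := by
  have hl := h.length_le
  rw [length_restr] at hl
  exact (List.prefix_of_prefix_length_le h (restr_prefix x hl) (by simp)).eq_of_length (by simp)

/-- A strictly increasing sequence of finite sequences converges to an infinite one. -/
theorem exists_limit_of_chain (c : ℕ → List A) (hc : ∀ n, PInit (c n) (c (n + 1))) :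
    StrictMono (fun n => (c n).length) ∧ ∃ x : ℕ → A, ∀ n, restr x (c n).length = c n := by
  have hm : StrictMono (fun n => (c n).length) := strictMono_nat_of_lt_succ fun n => (hc n).length_lt
  have hp : ∀ m n, m ≤ n → c m <+: c n := fun m n h => by
    induction n, h using Nat.le_induction with
    | base => exact List.prefix_rfl
    | succ n _ ih => exact ih.trans (hc n).1
  have hl : ∀ n, n ≤ (c n).length := fun n => hm.le_apply
  have hl' : ∀ i, i < (c (i + 1)).length := fun i => hl (i + 1)
  refine ⟨hm, fun i => (c (i + 1))[i]'(hl' i), fun n => ?_⟩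
  refine List.ext_getElem (by simp) fun i h1 h2 => ?_
  rw [getElem_restr]
  rcases le_total (i + 1) n with h | h
  · exact (hp _ _ h).getElem (hl' i)
  · exact ((hp _ _ h).getElem h2).symm

end Lists

/-! ### Quasi trees -/

section QuasiTrees

variable {A : Type} {T : Set (List A)}

theorem IsRoot.unique {r r' : List A} (h : IsRoot T r) (h' : IsRoot T r') : r = r' :=
  prefix_antisymm (h.2 _ h'.1) (h'.2 _ h.1)

theorem exists_suc_prefix {s u : List A} (hu : u ∈ T) (h : PInit s u) :
    ∃ w ∈ suc T s, w <+: u := by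
  obtain ⟨w, ⟨hw, hsw, hwu⟩, hmin⟩ := (measure (List.length (α := A))).wf.has_min
    {w | w ∈ T ∧ PInit s w ∧ w <+: u} ⟨u, hu, h, List.prefix_rfl⟩
  exact ⟨w, ⟨hw, hsw, fun ⟨v, hv, hsv, hvw⟩ =>
    hmin v ⟨hv, hsv, hvw.1.trans hwu⟩ hvw.length_lt⟩, hwu⟩

theorem exists_mem_suc {r u : List A} (hr : IsRoot T r) (hu : u ∈ T) (hru : r ≠ u) :
    ∃ v ∈ T, u ∈ suc T v := by
  obtain ⟨v, ⟨hv, hvu⟩, hmin⟩ := (measure (fun v : List A => u.length - v.length)).wf.has_min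
    {v | v ∈ T ∧ PInit v u} ⟨r, hr.1, hr.2 u hu, hru⟩
  refine ⟨v, hv, hu, hvu, fun ⟨w, hw, hvw, hwu⟩ => hmin w ⟨hw, hwu⟩ ?_⟩
  have := hvw.length_lt
  have := hwu.length_lt
  change u.length - w.length < u.length - v.length
  omega

theorem mem_hat {s : List A} : s ∈ hat T ↔ s ∈ T ∧ ∃ u ∈ T, PInit s u := by
  refine ⟨fun h => ⟨h.1, by_contra fun h' => h.2 ⟨h.1, h'⟩⟩, fun h => ⟨h.1, fun h' => h'.2 h.2⟩⟩

theorem mem_maxPts {s : List A} : s ∈ maxPts T ↔ s ∈ T ∧ ∀ u ∈ T, ¬ PInit s u := by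
  simp [maxPts]

theorem mem_hat_of_mem_suc {s u : List A} (hs : s ∈ T) (hu : u ∈ suc T s) : s ∈ hat T :=
  mem_hat.2 ⟨hs, u, hu.1, hu.2.1⟩

theorem mem_hat_or_mem_maxPts {s : List A} (hs : s ∈ T) : s ∈ hat T ∨ s ∈ maxPts T := by
  by_cases h : s ∈ maxPts T
  · exact .inr h
  · exact .inl ⟨hs, h⟩

theorem not_pInit_of_mem_suc {s u v : List A} (hu : u ∈ suc T s) (hv : v ∈ suc T s) :
    ¬ PInit u v := fun h => hv.2.2 ⟨u, hu.1, hu.2.1, h⟩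

theorem suc_antichain_eq {s u v w : List A} (hu : u ∈ suc T s) (hv : v ∈ suc T s)
    (huw : u <+: w) (hvw : v <+: w) : u = v := by
  rcases prefix_or_pInit huw hvw with h | h
  · exact (eq_or_pInit h).resolve_right (not_pInit_of_mem_suc hu hv)
  · exact absurd h (not_pInit_of_mem_suc hv hu)

/-- Every point of a quasi tree without maximal points lies on an infinite branch. -/
theorem exists_branch {s : List A} (hT : maxPts T = ∅) (hs : s ∈ T) :
    ∃ x ∈ lim T, restr x s.length = s := by
  have hex : ∀ u : T, ∃ v : T, PInit u.1 v.1 := fun u => by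
    by_contra! h
    exact (hT ▸ mem_maxPts.2 ⟨u.2, fun v hv => h ⟨v, hv⟩⟩ : u.1 ∈ (∅ : Set (List A)))
  choose f hf using hex
  obtain ⟨hm, x, hx⟩ := exists_limit_of_chain (fun n => (f^[n] ⟨s, hs⟩).1)
    fun n => by rw [Function.iterate_succ_apply']; exact hf _
  refine ⟨x, fun m => ⟨_, lt_of_lt_of_le (Nat.lt_succ_self m) (hm.le_apply (x := m + 1)), ?_⟩, hx 0⟩
  rw [hx]
  exact (f^[m + 1] ⟨s, hs⟩).2

theorem wellFounded_of_lim_eq_empty (h : lim T = ∅) :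
    WellFounded (fun u s : T => PInit s.1 u.1) := by
  rw [wellFounded_iff_isEmpty_descending_chain]
  refine ⟨fun ⟨c, hc⟩ => ?_⟩
  obtain ⟨hm, x, hx⟩ := exists_limit_of_chain (fun n => (c n).1) hc
  refine (h ▸ fun m => ⟨_, lt_of_lt_of_le (Nat.lt_succ_self m) (hm.le_apply (x := m + 1)), ?_⟩ :
    x ∈ (∅ : Set (ℕ → A)))
  rw [hx]
  exact (c (m + 1)).2

theorem lim_eq_empty_of_wellFounded (h : WellFounded (fun u s : T => PInit s.1 u.1)) :
    lim T = ∅ := by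
  refine eq_empty_of_forall_notMem fun x hx => ?_
  obtain ⟨n, -, hn⟩ := hx 0
  obtain ⟨⟨_, hk⟩, ⟨k, rfl⟩, hmin⟩ := h.has_min {s : T | ∃ k, s.1 = restr x k} ⟨⟨_, hn⟩, n, rfl⟩
  obtain ⟨l, hl, hl'⟩ := hx k
  exact hmin ⟨_, hl'⟩ ⟨l, rfl⟩ (restr_pInit x hl)

/-- A well founded quasi tree with finite successor sets is finite. -/
theorem finite_of_lim_eq_empty (hT : IsQuasiTree T) (h : lim T = ∅)
    (hf : ∀ v ∈ hat T, (suc T v).Finite) : T.Finite := by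
  -- König's lemma by induction from the top of the tree: the part above `s` is `s` together with
  -- finitely many parts above its successors.
  have key : ∀ s : T, {u ∈ T | s.1 <+: u}.Finite := fun s => by
    induction s using (wellFounded_of_lim_eq_empty h).induction with
    | _ s ih =>
    by_cases hs : s.1 ∈ hat T
    · refine ((finite_singleton s.1).union ((hf _ hs).biUnion (t := fun v => {u ∈ T | v <+: u})
        fun v hv => ih ⟨v, hv.1⟩ hv.2.1)).subset ?_
      rintro u ⟨hu, hsu⟩
      rcases eq_or_pInit hsu with e | hsu
      · exact .inl e.symm
      · obtain ⟨w, hw, hwu⟩ := exists_suc_prefix hu hsu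
        exact .inr (mem_biUnion hw ⟨hu, hwu⟩)
    · refine (finite_singleton s.1).subset ?_
      rintro u ⟨hu, hsu⟩
      exact ((eq_or_pInit hsu).resolve_right fun h => hs (mem_hat.2 ⟨s.2, u, hu, h⟩)).symm
  obtain ⟨r, hr⟩ := hT
  exact (key ⟨r, hr.1⟩).subset fun u hu => ⟨hu, hr.2 u hu⟩

/-- To verify the norm condition number `4` it is enough to find bars. -/
theorem normCondition_four {D : Type} {t : List A → WeakCreature A D} (hT : maxPts T = ∅)
    (h : ∀ n : ℕ, ∃ E ⊆ T, (∀ x ∈ lim T, ∃ k, restr x k ∈ E) ∧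
      ∀ v ∈ E, ∀ u ∈ T, PInit v u → (n : ℝ) ≤ (t u).nor) : NormCondition T t 4 := by
  intro n
  obtain ⟨E, hE, hbar, hnor⟩ := h n
  -- A front must be an antichain, so only the minimal points of the bar are kept; each branch still
  -- meets them, at its first point in `E`.
  refine ⟨{v ∈ E | ∀ u ∈ E, ¬ PInit u v}, ⟨fun v hv => hE hv.1, fun s hs u hu => hu.2 s hs.1,
    fun x hx => ?_, by simp [hT]⟩, fun v hv => hnor v hv.1⟩
  classical
  have hk := hbar x hx
  refine ⟨Nat.find hk, Nat.find_spec hk, fun u hu hux => ?_⟩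
  rw [eq_restr_of_prefix hux.1] at hu
  have := hux.length_lt
  rw [length_restr] at this
  exact Nat.find_min hk this hu

/-- A front cuts every branch, after which the norms along the branch stay large: this is condition
`1`, which implies `0`, and `2` because every point lies on a branch. For `3`, follow a branch
through the given point until it has passed the front. -/
theorem normCondition_of_four {D : Type} {t : List A → WeakCreature A D} (hT : maxPts T = ∅)
    (h : NormCondition T t 4) (e : Fin 5) : NormCondition T t e := by
  have h1 : NormCondition T t 1 := fun x hx b => by
    obtain ⟨n, hn⟩ := exists_nat_ge b
    obtain ⟨F, hF, hnor⟩ := h n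
    obtain ⟨k, hk⟩ := hF.2.2.1 x hx
    exact ⟨k + 1, fun j hj hjT => hn.trans (hnor _ hk _ hjT (restr_pInit x hj))⟩
  fin_cases e
  · intro x hx b m
    obtain ⟨l, hl⟩ := h1 x hx b
    obtain ⟨k, hk, hkT⟩ := hx (max l m)
    exact ⟨k, by omega, hkT, hl k (by omega) hkT⟩
  · exact h1
  · intro s hs n
    obtain ⟨x, hx, hxs⟩ := exists_branch hT hs
    obtain ⟨m, hm⟩ := h1 x hx n
    obtain ⟨k, hk, hkT⟩ := hx (max m s.length)
    exact ⟨_, hkT, hxs ▸ restr_pInit x (by omega), hm k (by omega) hkT⟩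
  · intro s hs n
    obtain ⟨x, hx, hxs⟩ := exists_branch hT hs
    obtain ⟨F, hF, hnor⟩ := h n
    obtain ⟨m, hm⟩ := hF.2.2.1 x hx
    obtain ⟨k, hk, hkT⟩ := hx (max m s.length)
    exact ⟨_, hkT, hxs ▸ restr_pInit x (by omega), fun u hu hku =>
      hnor _ hm u hu ((restr_pInit x (by omega)).trans hku)⟩
  · exact h

/-- Condition `2` only asks for isolated points of large norm, and each of the other conditions
supplies them on a branch through the given point. -/
theorem normCondition_two {D : Type} {t : List A → WeakCreature A D} (hT : maxPts T = ∅)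
    {e : Fin 5} (h : NormCondition T t e) : NormCondition T t 2 := by
  have h0 : NormCondition T t 0 → NormCondition T t 2 := fun h s hs n => by
    obtain ⟨x, hx, hxs⟩ := exists_branch hT hs
    obtain ⟨k, hk, hkT, hkn⟩ := h x hx n (s.length + 1)
    exact ⟨_, hkT, hxs ▸ restr_pInit x (by omega), hkn⟩
  fin_cases e
  · exact h0 h
  · refine h0 fun x hx b m => ?_
    obtain ⟨l, hl⟩ := h x hx b
    obtain ⟨k, hk, hkT⟩ := hx (max l m)
    exact ⟨k, by omega, hkT, hl k (by omega) hkT⟩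
  · exact h
  · intro s hs n
    obtain ⟨v, hv, hsv, hnor⟩ := h s hs n
    obtain ⟨x, hx, hxv⟩ := exists_branch hT hv
    obtain ⟨k, hk, hkT⟩ := hx v.length
    have hvk : PInit v (restr x k) := hxv ▸ restr_pInit x (by simpa [hxv] using hk)
    exact ⟨_, hkT, hsv.trans hvk, hnor _ hkT hvk⟩
  · exact normCondition_of_four hT h 2

end QuasiTrees

/-! ### Systems of tree-creatures -/

section Systems

variable {A D : Type} {H : ℕ → Set A} {K : Set (WeakCreature A D)} {T : Set (List A)}
  {s : List A → WeakCreature A D}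

theorem IsTreeCreatureAt.exists_mem {v : List A} {t : WeakCreature A D}
    (h : IsTreeCreatureAt H v t) : ∃ u, (v, u) ∈ t.val := by
  obtain ⟨⟨w, u⟩, hz⟩ := h.1.2.1
  obtain rfl : w = v := h.2.1 _ hz
  exact ⟨u, hz⟩

theorem IsTreeCreatureAt.mem_val {v w u : List A} {t : WeakCreature A D}
    (h : IsTreeCreatureAt H v t) (hw : (w, u) ∈ t.val) : w = v := h.2.1 _ hw

theorem IsTreeCreatureAt.unique {v w : List A} {t : WeakCreature A D}
    (h : IsTreeCreatureAt H v t) (h' : IsTreeCreatureAt H w t) : v = w :=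
  h'.mem_val h.exists_mem.choose_spec

theorem IsTreeCreatureAt.mem_rng {v u : List A} {t : WeakCreature A D}
    (h : IsTreeCreatureAt H v t) : u ∈ t.rng ↔ (v, u) ∈ t.val :=
  ⟨fun ⟨_, hw⟩ => h.mem_val hw ▸ hw, fun hu => ⟨v, hu⟩⟩

theorem IsTreeCreatureAt.rng_nonempty {v : List A} {t : WeakCreature A D}
    (h : IsTreeCreatureAt H v t) : t.rng.Nonempty :=
  h.exists_mem.imp fun _ => h.mem_rng.2

theorem IsTreeCreatureAt.pInit {v u : List A} {t : WeakCreature A D}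
    (h : IsTreeCreatureAt H v t) (hu : u ∈ t.rng) : PInit v u :=
  (h.1.2.2 _ (h.mem_rng.1 hu)).2.2

theorem IsTreeCreatureAt.rng_subset {v : List A} {t : WeakCreature A D}
    (h : IsTreeCreatureAt H v t) : t.rng ⊆ FinSeq H :=
  fun _ hu => (h.1.2.2 _ (h.mem_rng.1 hu)).2.1

theorem IsTreeCreatureAt.base_mem {v : List A} {t : WeakCreature A D}
    (h : IsTreeCreatureAt H v t) : v ∈ FinSeq H :=
  (h.1.2.2 _ h.exists_mem.choose_spec).1

theorem IsTreeCreatureAt.finite_rng {v : List A} {t : WeakCreature A D}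
    (h : IsTreeCreatureAt H v t) (hf : t.val.Finite) : t.rng.Finite :=
  (hf.image Prod.snd).subset fun _ hu => ⟨_, h.mem_rng.1 hu, rfl⟩

/-- A single tree-creature is a system. -/
theorem isSystem_single {v : List A} {t : WeakCreature A D} (htK : t ∈ K)
    (ht : IsTreeCreatureAt H v t) :
    IsSystem H K (insert v t.rng) (fun _ => t) ∧ hat (insert v t.rng) = {v} ∧
      maxPts (insert v t.rng) = t.rng ∧ IsRoot (insert v t.rng) v := by
  have hroot : IsRoot (insert v t.rng) v :=
    ⟨mem_insert _ _, fun u hu => hu.elim (fun e => e ▸ List.prefix_rfl) fun h => (ht.pInit h).1⟩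
  have hmax : maxPts (insert v t.rng) = t.rng := by
    ext u
    refine ⟨fun h => (mem_maxPts.1 h).1.resolve_left ?_, fun h => mem_maxPts.2 ⟨.inr h, ?_⟩⟩
    · rintro rfl
      obtain ⟨w, hw⟩ := ht.rng_nonempty
      exact (mem_maxPts.1 h).2 w (.inr hw) (ht.pInit hw)
    · rintro w (rfl | hw) huw
      · exact pInit_irrefl u (huw.trans (ht.pInit h))
      · exact ht.2.2 u h w hw huw
  have hhat : hat (insert v t.rng) = {v} := by
    ext u
    rw [hat, hmax]
    refine ⟨fun h => h.1.resolve_right h.2, ?_⟩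
    rintro rfl
    exact ⟨.inl rfl, fun h => pInit_irrefl u (ht.pInit h)⟩
  refine ⟨⟨?_, ⟨v, hroot⟩, ?_, fun _ _ => htK, ?_, ?_⟩, hhat, hmax, hroot⟩
  · rintro u (rfl | hu)
    exacts [ht.base_mem, ht.rng_subset hu]
  -- Two points of a branch that are longer than `v` would be comparable members of the antichain
  -- `t.rng`.
  · refine eq_empty_of_forall_notMem fun x hx => ?_
    obtain ⟨n, hvn, hn⟩ := hx v.length
    obtain ⟨m, hm, hmT⟩ := hx n
    have hmr : restr x m ∈ t.rng := by
      rcases hmT with e | h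
      · have := congrArg List.length e
        simp only [length_restr] at this
        omega
      · exact h
    rcases hn with e | h
    · have := congrArg List.length e
      simp only [length_restr] at this
      omega
    · exact ht.2.2 _ h _ hmr (restr_pInit x hm)
  · rw [hhat]
    rintro _ rfl
    exact ht
  · rw [hhat]
    rintro _ rfl
    ext u
    refine ⟨fun h => ⟨.inr h, ht.pInit h, ?_⟩, fun h => h.1.resolve_left ?_⟩
    · rintro ⟨w, rfl | hw, hvw, hwu⟩
      · exact pInit_irrefl _ hvw
      · exact ht.2.2 _ hw _ h hwu
    · rintro rfl
      exact pInit_irrefl _ h.2.1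

/-- Systems `σ v` placed along the trees `U v` may be substituted into a system. -/
theorem IsSystem.bind (hs : IsSystem H K T s) (hne : (hat T).Nonempty)
    (U : List A → Set (List A)) (σ : List A → List A → WeakCreature A D)
    (hσ : ∀ v ∈ hat T, IsSystem H K (U v) (σ v)) (hr : ∀ v ∈ hat T, IsRoot (U v) v)
    (hU : ∀ v ∈ hat T, suc T v ⊆ maxPts (U v)) :
    ∃ (T' : Set (List A)) (s' : List A → WeakCreature A D), IsSystem H K T' s' ∧
      s' '' hat T' = (⋃ v ∈ hat T, σ v '' hat (U v)) ∧ (∀ r, IsRoot T r → IsRoot T' r) ∧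
      maxPts T ⊆ maxPts T' := by
  classical
  -- a point of `U u` properly above a point of `U v` lies in `U v` or above a successor of `v`
  have step : ∀ v ∈ hat T, ∀ u ∈ hat T, ∀ z ∈ U v, ∀ y ∈ U u, PInit z y → u = v ∨ PInit v u := by
    intro v hv u hu z hz y hy hzy
    have hvy := PInit.prefix_trans ((hr v hv).2 z hz) hzy
    rcases prefix_or_pInit hvy.1 ((hr u hu).2 y hy) with h | h
    · exact (eq_or_pInit h).imp_left Eq.symm
    · exfalso
      obtain ⟨w, hw, hwv⟩ := exists_suc_prefix hv.1 h
      exact (mem_maxPts.1 (hU u hu hw)).2 y hy (PInit.prefix_trans hwv hvy)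
  have above : ∀ v ∈ hat T, ∀ u ∈ hat T, PInit v u → ∃ w ∈ suc T v, w <+: u :=
    fun v _ u hu h => exists_suc_prefix hu.1 h
  have hatU : ∀ v ∈ hat T, v ∈ hat (U v) := fun v hv => by
    obtain ⟨w, hw, hvw⟩ := (mem_hat.1 hv).2
    obtain ⟨w', hw', -⟩ := exists_suc_prefix hw hvw
    exact mem_hat.2 ⟨(hr v hv).1, w', (mem_maxPts.1 (hU v hv hw')).1, hw'.2.1⟩
  -- A point below a proper extension in `U v` cannot lie above a successor of `v`, which is maximal
  -- in `U v`. So non-maximal points belong to only one of the trees.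
  have uniq : ∀ v ∈ hat T, ∀ u ∈ hat T, ∀ z ∈ hat (U v), z ∈ hat (U u) → u = v := by
    have aux : ∀ v ∈ hat T, ∀ u ∈ hat T, ∀ z ∈ hat (U v), z ∈ hat (U u) → ¬ PInit v u := by
      intro v hv u hu z hz hz' h
      obtain ⟨w, hw, hwu⟩ := above v hv u hu h
      obtain ⟨y, hy, hzy⟩ := (mem_hat.1 hz).2
      exact (mem_maxPts.1 (hU v hv hw)).2 y hy
        (PInit.prefix_trans (hwu.trans ((hr u hu).2 z hz'.1)) hzy)
    intro v hv u hu z hz hz'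
    obtain ⟨y, hy, hzy⟩ := (mem_hat.1 hz').2
    exact (step v hv u hu z hz.1 y hy hzy).resolve_right (aux v hv u hu z hz hz')
  -- A tree `U v` may have maximal points that are not successors of `v` in `T`; they simply remain,
  -- and successors in `hat T` are continued by their own trees.
  set T' : Set (List A) := ⋃ v ∈ hat T, U v with hT'
  have memT' : ∀ z, z ∈ T' ↔ ∃ v ∈ hat T, z ∈ U v := fun z => by simp [hT']
  have hat' : ∀ z, z ∈ hat T' ↔ ∃ v ∈ hat T, z ∈ hat (U v) := by
    refine fun z => ⟨fun h => ?_, fun ⟨v, hv, hz⟩ => ?_⟩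
    · obtain ⟨hz, y, hy, hzy⟩ := mem_hat.1 h
      obtain ⟨v, hv, hz⟩ := (memT' z).1 hz
      obtain ⟨u, hu, hy⟩ := (memT' y).1 hy
      rcases step v hv u hu z hz y hy hzy with rfl | hvu
      · exact ⟨u, hu, mem_hat.2 ⟨hz, y, hy, hzy⟩⟩
      · obtain ⟨w, hw, hwu⟩ := above v hv u hu hvu
        have hwy := hwu.trans ((hr u hu).2 y hy)
        rcases prefix_or_pInit hwy hzy.1 with h | h
        · -- here `z` extends `w`, so that `z = w`
          have hwz : w = z :=
            (eq_or_pInit h).resolve_right ((mem_maxPts.1 (hU v hv hw)).2 z hz)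
          subst hwz
          rcases eq_or_pInit hwu with e | hwu
          · exact ⟨u, hu, e ▸ hatU u hu⟩
          · have hwT : w ∈ hat T := mem_hat.2 ⟨hw.1, u, hu.1, hwu⟩
            exact ⟨w, hwT, hatU w hwT⟩
        · exact ⟨v, hv, mem_hat.2 ⟨hz, w, (mem_maxPts.1 (hU v hv hw)).1, h⟩⟩
    · obtain ⟨hz, y, hy, hzy⟩ := mem_hat.1 hz
      exact mem_hat.2 ⟨(memT' z).2 ⟨v, hv, hz⟩, y, (memT' y).2 ⟨v, hv, hy⟩, hzy⟩
  have sucEq : ∀ v ∈ hat T, ∀ z ∈ hat (U v), suc T' z = suc (U v) z := by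
    intro v hv z hz
    have split : ∀ y ∈ T', PInit z y → ∃ y' ∈ U v, PInit z y' ∧ y' <+: y := by
      intro y hy hzy
      obtain ⟨u, hu, hy⟩ := (memT' y).1 hy
      rcases step v hv u hu z hz.1 y hy hzy with rfl | hvu
      · exact ⟨y, hy, hzy, List.prefix_rfl⟩
      · obtain ⟨w, hw, hwu⟩ := above v hv u hu hvu
        have hwy := hwu.trans ((hr u hu).2 y hy)
        have hwm := mem_maxPts.1 (hU v hv hw)
        refine ⟨w, hwm.1, (prefix_or_pInit hwy hzy.1).resolve_left fun h => ?_, hwy⟩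
        obtain ⟨y', hy', hzy'⟩ := (mem_hat.1 hz).2
        exact hwm.2 y' hy' (PInit.prefix_trans h hzy')
    ext y
    constructor
    · rintro ⟨hy, hzy, hmin⟩
      obtain ⟨y', hy', hzy', hyy'⟩ := split y hy hzy
      obtain rfl | h := eq_or_pInit hyy'
      · exact ⟨hy', hzy, fun ⟨w, hw, h1, h2⟩ => hmin ⟨w, (memT' w).2 ⟨v, hv, hw⟩, h1, h2⟩⟩
      · exact absurd ⟨y', (memT' y').2 ⟨v, hv, hy'⟩, hzy', h⟩ hmin
    · rintro ⟨hy, hzy, hmin⟩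
      refine ⟨(memT' y).2 ⟨v, hv, hy⟩, hzy, fun ⟨w, hw, h1, h2⟩ => ?_⟩
      obtain ⟨w', hw', h1', h2'⟩ := split w hw h1
      exact hmin ⟨w', hw', h1', PInit.prefix_trans h2' h2⟩
  -- Nested induction, along `T` for the tree containing the point and inside that tree: a step
  -- upwards either stays in `U v` or moves to `U u` with `u` properly above `v`.
  have wf : WellFounded (fun u s : T' => PInit s.1 u.1) := by
    have key : ∀ v : T, v.1 ∈ hat T → ∀ z : U v.1, ∀ hz : z.1 ∈ T',
        Acc (fun u s : T' => PInit s.1 u.1) ⟨z.1, hz⟩ := fun v => by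
      induction v using (wellFounded_of_lim_eq_empty hs.wellFounded).induction with
      | _ v ihv =>
      intro hv z
      induction z using (wellFounded_of_lim_eq_empty (hσ v.1 hv).wellFounded).induction with
      | _ z ihz =>
      intro hz
      refine ⟨_, fun ⟨y, hyT⟩ hzy => ?_⟩
      obtain ⟨u, hu, hy⟩ := (memT' y).1 hyT
      rcases step v.1 hv u hu z.1 z.2 y hy hzy with rfl | hvu
      · exact ihz ⟨y, hy⟩ hzy hyT
      · exact ihv ⟨u, hu.1⟩ hvu hu ⟨y, hy⟩ hyT
    refine ⟨fun ⟨z, hz⟩ => ?_⟩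
    obtain ⟨v, hv, hz'⟩ := (memT' z).1 hz
    exact key ⟨v, hv.1⟩ hv ⟨z, hz'⟩ hz
  have root' : ∀ r, IsRoot T r → IsRoot T' r := by
    intro r hr'
    obtain ⟨v, hv⟩ := hne
    have hrT : r ∈ hat T := by
      rcases eq_or_pInit (hr'.2 v hv.1) with e | h
      · exact e ▸ hv
      · exact mem_hat.2 ⟨hr'.1, v, hv.1, h⟩
    refine ⟨(memT' r).2 ⟨r, hrT, (hr r hrT).1⟩, fun z hz => ?_⟩
    obtain ⟨u, hu, hz⟩ := (memT' z).1 hz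
    exact (hr'.2 u hu.1).trans ((hr u hu).2 z hz)
  let s' : List A → WeakCreature A D := fun z =>
    if h : ∃ v ∈ hat T, z ∈ hat (U v) then σ h.choose z else s z
  have s'_eq : ∀ v ∈ hat T, ∀ z ∈ hat (U v), s' z = σ v z := by
    intro v hv z hz
    have h : ∃ v ∈ hat T, z ∈ hat (U v) := ⟨v, hv, hz⟩
    have : h.choose = v := uniq v hv _ h.choose_spec.1 z hz h.choose_spec.2
    simp only [s', dif_pos h, this]
  refine ⟨T', s', ⟨fun z hz => ?_, hs.quasiTree.imp root', lim_eq_empty_of_wellFounded wf, ?_, ?_,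
    ?_⟩, ?_, root', ?_⟩
  · obtain ⟨v, hv, hz⟩ := (memT' z).1 hz
    exact (hσ v hv).subset hz
  · intro z hz
    obtain ⟨v, hv, hz⟩ := (hat' z).1 hz
    rw [s'_eq v hv z hz]
    exact (hσ v hv).mem z hz
  · intro z hz
    obtain ⟨v, hv, hz⟩ := (hat' z).1 hz
    rw [s'_eq v hv z hz]
    exact (hσ v hv).treeCreature z hz
  · intro z hz
    obtain ⟨v, hv, hz⟩ := (hat' z).1 hz
    rw [s'_eq v hv z hz, sucEq v hv z hz]
    exact (hσ v hv).rng_eq z hz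
  · ext t
    simp only [mem_image, mem_iUnion]
    constructor
    · rintro ⟨z, hz, rfl⟩
      obtain ⟨v, hv, hz⟩ := (hat' z).1 hz
      exact ⟨v, hv, z, hz, (s'_eq v hv z hz).symm⟩
    · rintro ⟨v, hv, z, hz, rfl⟩
      exact ⟨z, (hat' z).2 ⟨v, hv, hz⟩, s'_eq v hv z hz⟩
  · intro z hz
    obtain ⟨r, hr'⟩ := hs.quasiTree
    have hrz : r ≠ z := by
      rintro rfl
      obtain ⟨v, hv⟩ := hne
      rcases eq_or_pInit (hr'.2 v hv.1) with e | h
      · exact hv.2 (e ▸ hz)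
      · exact (mem_maxPts.1 hz).2 v hv.1 h
    obtain ⟨v, hvT, hvz⟩ := exists_mem_suc hr' hz.1 hrz
    have hv := mem_hat_of_mem_suc hvT hvz
    have hzm := mem_maxPts.1 (hU v hv hvz)
    refine mem_maxPts.2 ⟨(memT' z).2 ⟨v, hv, hzm.1⟩, fun y hy hzy => ?_⟩
    obtain ⟨u, hu, hy⟩ := (memT' y).1 hy
    rcases step v hv u hu z hzm.1 y hy hzy with rfl | hvu
    · exact hzm.2 y hy hzy
    · obtain ⟨w, hw, hwu⟩ := above v hv u hu hvu
      have hwz : w = z := suc_antichain_eq hw hvz (hwu.trans ((hr u hu).2 y hy)) hzy.1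
      subst hwz
      rcases eq_or_pInit hwu with e | h
      · exact hu.2 (e ▸ hz)
      · exact (mem_maxPts.1 hz).2 u hu.1 h

end Systems

/-! ### The largest composition operation on a family of tree-creatures -/

section FullSig

variable {A D : Type} {H : ℕ → Set A} {K : Set (WeakCreature A D)} {T : Set (List A)}
  {s : List A → WeakCreature A D}

/-- The points at which the creatures from `S` are located. -/
def dom (S : Set (WeakCreature A D)) : Set (List A) := {v | ∃ t ∈ S, ∃ u, (v, u) ∈ t.val}

/-- The points in the ranges of creatures from `S` at which no creature from `S` is located. -/
def ends (S : Set (WeakCreature A D)) : Set (List A) := {u | ∃ t ∈ S, u ∈ t.rng} \ dom S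

/-- Every creature from `K` at the root whose range consists of end points may be composed from
a system. -/
def fullSig (H : ℕ → Set A) (K : Set (WeakCreature A D)) (S : Set (WeakCreature A D)) :
    Set (WeakCreature A D) :=
  {t ∈ K | (∃ (T : Set (List A)) (s : List A → WeakCreature A D),
    IsSystem H K T s ∧ S = s '' hat T) ∧
    ∃ v, IsRoot (dom S) v ∧ IsTreeCreatureAt H v t ∧ t.rng ⊆ ends S}

theorem IsSystem.dom_eq (hs : IsSystem H K T s) : dom (s '' hat T) = hat T := by
  ext v
  constructor
  · rintro ⟨_, ⟨w, hw, rfl⟩, u, hu⟩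
    rwa [(hs.treeCreature w hw).mem_val hu]
  · exact fun hv => ⟨_, ⟨v, hv, rfl⟩, (hs.treeCreature v hv).exists_mem⟩

theorem IsSystem.ends_subset (hs : IsSystem H K T s) : ends (s '' hat T) ⊆ maxPts T := by
  rintro u ⟨⟨_, ⟨w, hw, rfl⟩, hu⟩, hd⟩
  rw [hs.dom_eq] at hd
  rw [hs.rng_eq w hw] at hu
  exact (mem_hat_or_mem_maxPts hu.1).resolve_left hd

theorem IsSystem.mem_ends (hs : IsSystem H K T s) {r u : List A} (hr : IsRoot T r) (hru : r ≠ u)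
    (hu : u ∈ maxPts T) : u ∈ ends (s '' hat T) := by
  obtain ⟨v, hv, huv⟩ := exists_mem_suc hr hu.1 hru
  have hv' := mem_hat_of_mem_suc hv huv
  refine ⟨⟨_, ⟨v, hv', rfl⟩, hs.rng_eq v hv' ▸ huv⟩, ?_⟩
  rw [hs.dom_eq]
  exact fun h => h.2 hu

theorem isRoot_hat {r v : List A} (hr : IsRoot T r) (hv : v ∈ hat T) : IsRoot (hat T) r := by
  refine ⟨?_, fun u hu => hr.2 u hu.1⟩
  rcases eq_or_pInit (hr.2 v hv.1) with e | h
  · exact e ▸ hv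
  · exact mem_hat.2 ⟨hr.1, v, hv.1, h⟩

/-- `dom` and `ends` recover from the bare set of creatures the non-maximal points and the maximal
points other than the root. So it does not matter which system presents the set. A creature with
range in `maxPts T` forces `hat T` to be nonempty. -/
theorem IsSystem.mem_fullSig (hs : IsSystem H K T s) {t : WeakCreature A D} :
    t ∈ fullSig H K (s '' hat T) ↔
      t ∈ K ∧ ∃ r, IsRoot T r ∧ IsTreeCreatureAt H r t ∧ t.rng ⊆ maxPts T := by
  obtain ⟨r, hr⟩ := hs.quasiTree
  constructor
  · rintro ⟨htK, -, v, hv, hvt, hrng⟩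
    rw [hs.dom_eq] at hv
    rw [hv.unique (isRoot_hat hr hv.1)] at hvt
    exact ⟨htK, r, hr, hvt, hrng.trans hs.ends_subset⟩
  · rintro ⟨htK, r', hr', hrt, hrng⟩
    obtain rfl := hr.unique hr'
    obtain ⟨u, hu⟩ := hrt.rng_nonempty
    refine ⟨htK, ⟨T, s, hs, rfl⟩, r, ?_, hrt, fun w hw =>
      hs.mem_ends hr (hrt.pInit hw).2 (hrng hw)⟩
    rw [hs.dom_eq]
    exact isRoot_hat hr (mem_hat.2 ⟨hr.1, u, (hrng hu).1, hrt.pInit hu⟩)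

theorem mem_fullSig_singleton {v : List A} {t t' : WeakCreature A D} (htK : t ∈ K)
    (ht : IsTreeCreatureAt H v t) :
    t' ∈ fullSig H K {t} ↔ t' ∈ K ∧ IsTreeCreatureAt H v t' ∧ t'.rng ⊆ t.rng := by
  obtain ⟨hs, hhat, hmax, hroot⟩ := isSystem_single htK ht
  have h := hs.mem_fullSig (t := t')
  rw [hhat, image_singleton, hmax] at h
  rw [h]
  refine and_congr_right fun _ => ⟨?_, fun h => ⟨v, hroot, h⟩⟩
  rintro ⟨r, hr, h⟩
  rwa [hroot.unique hr]

/-- Transitivity is the only axiom with content: each creature of a system is itself composed from a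
system, and `IsSystem.bind` glues these while keeping the root and the old maximal points. -/
theorem isTreeCreatingPair_fullSig (hH : ∀ n, (H n).Nontrivial)
    (hK : ∀ t ∈ K, ∃ v, IsTreeCreatureAt H v t) : IsTreeCreatingPair H K (fullSig H K) where
  weakCreature t ht := (hK t ht).choose_spec.1
  sig_subset _ _ _ _ ht := ht.1
  transitivity S _ _ B hB t ht := by
    obtain ⟨-, ⟨T, s, hs, rfl⟩, -⟩ := id ht
    obtain ⟨htK, r, hr, hrt, hrng⟩ := hs.mem_fullSig.1 ht
    have h : ∀ v ∈ hat T, ∃ (U : Set (List A)) (σ : List A → WeakCreature A D),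
        IsSystem H K U σ ∧ B (s v) = σ '' hat U ∧ IsRoot U v ∧ suc T v ⊆ maxPts U := by
      intro v hv
      have hsv := (hB _ (mem_image_of_mem s hv)).2.2
      obtain ⟨-, ⟨U, σ, hσ, hU⟩, -⟩ := id hsv
      rw [hU] at hsv
      obtain ⟨-, r', hr', hvr', hrng'⟩ := hσ.mem_fullSig.1 hsv
      obtain rfl := hvr'.unique (hs.treeCreature v hv)
      exact ⟨U, σ, hσ, hU, hr', hs.rng_eq _ hv ▸ hrng'⟩
    have : Nonempty (WeakCreature A D) := ⟨t⟩
    choose! U σ hσ hBU hrU hmU using h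
    obtain ⟨u, hu⟩ := hrt.rng_nonempty
    have hne : (hat T).Nonempty := ⟨r, mem_hat.2 ⟨hr.1, u, (hrng hu).1, hrt.pInit hu⟩⟩
    obtain ⟨T', s', hs', himg, hroot, hmax⟩ := hs.bind hne U σ hσ hrU hmU
    rw [biUnion_image, iUnion₂_congr hBU, ← himg]
    exact hs'.mem_fullSig.2 ⟨htK, r, hroot r hr, hrt, hrng.trans hmax⟩
  self_mem t ht := by
    obtain ⟨v, hv⟩ := hK t ht
    exact (mem_fullSig_singleton ht hv).2 ⟨ht, hv, Subset.rfl⟩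
  sig_empty := eq_empty_of_forall_notMem fun t ⟨_, _, v, ⟨⟨_, h, _⟩, _⟩, _⟩ => h
  two_le := hH
  treeCreature := hK
  system_of_nonempty _ _ _ h := h.choose_spec.2.1
  mem_sig T s hs t ht := by
    obtain ⟨-, r, hr, hrt, hrng⟩ := hs.mem_fullSig.1 ht
    exact ⟨⟨r, hr, hrt⟩, hrng⟩

theorem pos_fullSig {v : List A} {t : WeakCreature A D} (htK : t ∈ K)
    (ht : IsTreeCreatureAt H v t) : pos (fullSig H K) v t = t.rng := by
  ext u
  constructor
  · rintro ⟨s, hs, hu⟩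
    exact ((mem_fullSig_singleton htK ht).1 hs).2.2 ⟨v, hu⟩
  · exact fun hu => ⟨t, (mem_fullSig_singleton htK ht).2 ⟨htK, ht, Subset.rfl⟩, ht.mem_rng.1 hu⟩

theorem basis_fullSig {v : List A} {t : WeakCreature A D} (htK : t ∈ K)
    (ht : IsTreeCreatureAt H v t) : basis H (fullSig H K) t = {v} := by
  ext w
  constructor
  · rintro ⟨-, s, hs, u, hu⟩
    exact ((mem_fullSig_singleton htK ht).1 hs).2.1.mem_val hu
  · rintro rfl
    exact ⟨ht.base_mem, t, (mem_fullSig_singleton htK ht).2 ⟨htK, ht, Subset.rfl⟩, ht.exists_mem⟩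

end FullSig

/-! ### Creatures with a logarithmic counting norm -/

section LogNorm

/-- The base of the logarithm used to count at place `m`. -/
def growth (m : ℕ) : ℕ := 2 ^ (m + 3)

/-- The finite alphabet used at place `m`. -/
def alphabet (m : ℕ) : Set ℕ := Iio (growth m ^ (m + 1))

/-- The values at place `m` of the sequences from `P`. -/
def vals (m : ℕ) (P : Set (List ℕ)) : Set ℕ := {x | ∃ w ∈ P, w[m]? = some x}

/-- The largest `k` such that at some place `m` at least `growth m ^ k` values are taken. -/
noncomputable def logNorm (P : Set (List ℕ)) : ℕ :=
  sSup {k | ∃ m, growth m ^ k ≤ (vals m P).ncard}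

variable {P Q : Set (List ℕ)}

theorem one_lt_growth (m : ℕ) : 1 < growth m := Nat.one_lt_two_pow (by omega)

theorem lt_growth (m : ℕ) : m < growth m :=
  Nat.lt_two_pow_self.trans (Nat.pow_lt_pow_right (by omega) (by omega))

theorem vals_finite (hP : P.Finite) (m : ℕ) : (vals m P).Finite :=
  (hP.image fun w => w[m]?.getD 0).subset fun x ⟨w, hw, hx⟩ => ⟨w, hw, by simp [hx]⟩

theorem ncard_vals_le (hP : P.Finite) (m : ℕ) : (vals m P).ncard ≤ P.ncard :=
  (ncard_le_ncard (fun x ⟨w, hw, hx⟩ => ⟨w, hw, by simp [hx]⟩ :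
    vals m P ⊆ (fun w => w[m]?.getD 0) '' P) (hP.image _)).trans (ncard_image_le hP)

theorem bddAbove_logNorm (hP : P.Finite) :
    BddAbove {k | ∃ m, growth m ^ k ≤ (vals m P).ncard} :=
  ⟨P.ncard, fun _ ⟨m, hm⟩ =>
    ((Nat.lt_pow_self (one_lt_growth m)).le.trans hm).trans (ncard_vals_le hP m)⟩

theorem le_logNorm (hP : P.Finite) {m k : ℕ} (h : growth m ^ k ≤ (vals m P).ncard) :
    k ≤ logNorm P := le_csSup (bddAbove_logNorm hP) ⟨m, h⟩

theorem exists_le_ncard_vals (hP : P.Finite) {k : ℕ} (hk : 1 ≤ k) (h : k ≤ logNorm P) :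
    ∃ m, growth m ^ k ≤ (vals m P).ncard := by
  have hne : {k | ∃ m, growth m ^ k ≤ (vals m P).ncard}.Nonempty := by
    by_contra hne
    rw [not_nonempty_iff_eq_empty] at hne
    rw [logNorm, hne, csSup_empty] at h
    exact absurd (hk.trans h) (by simp)
  obtain ⟨m, hm⟩ := Nat.sSup_mem hne (bddAbove_logNorm hP)
  exact ⟨m, (Nat.pow_le_pow_right (one_lt_growth m).le h).trans hm⟩

/-- A value taken at place `m` by `w` is taken there by every extension of `w`. -/
theorem logNorm_mono (hQ : Q.Finite) (h : ∀ w ∈ P, ∃ u ∈ Q, w <+: u) (hP : P.Finite) :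
    logNorm P ≤ logNorm Q := by
  rcases Nat.eq_zero_or_pos (logNorm P) with h0 | h0
  · omega
  · obtain ⟨m, hm⟩ := exists_le_ncard_vals hP h0 le_rfl
    refine le_logNorm hQ (hm.trans (ncard_le_ncard ?_ (vals_finite hQ m)))
    rintro x ⟨w, hw, hx⟩
    obtain ⟨u, hu, hwu⟩ := h w hw
    obtain ⟨hm', rfl⟩ := List.getElem?_eq_some_iff.1 hx
    exact ⟨u, hu, List.getElem?_eq_some_iff.2 ⟨hm'.trans_le hwu.length_le, (hwu.getElem hm').symm⟩⟩

/-- A place at which extensions of `v` take two different values is not below the length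
of `v`. -/
theorem length_le_of_one_lt_ncard_vals {v : List ℕ} (hP : ∀ w ∈ P, v <+: w) {m : ℕ}
    (h : 1 < (vals m P).ncard) : v.length ≤ m := by
  by_contra! hm
  refine absurd h (not_lt.2 ?_)
  refine (ncard_le_ncard (t := {v[m]}) ?_ (finite_singleton _)).trans (ncard_singleton _).le
  rintro x ⟨w, hw, hx⟩
  obtain ⟨hm', rfl⟩ := List.getElem?_eq_some_iff.1 hx
  exact ((hP w hw).getElem hm).symm

/-- Finite tree-creatures with the logarithmic norm. -/
def logCreatures : Set (WeakCreature ℕ Unit) :=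
  {t | t.val.Finite ∧ (∃ v, IsTreeCreatureAt alphabet v t) ∧ t.nor = logNorm t.rng}

/-- The composition operation on creatures with the logarithmic norm. -/
abbrev logSig : Set (WeakCreature ℕ Unit) → Set (WeakCreature ℕ Unit) :=
  fullSig alphabet logCreatures

/-- The creature at `v` with range `P` and the logarithmic norm. -/
noncomputable def logCreature (v : List ℕ) (P : Set (List ℕ)) : WeakCreature ℕ Unit :=
  ⟨logNorm P, {v} ×ˢ P, ()⟩

theorem rng_logCreature (v : List ℕ) (P : Set (List ℕ)) : (logCreature v P).rng = P := by
  ext u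
  simp [logCreature, WeakCreature.rng]

theorem logCreature_spec {v : List ℕ} (hv : v ∈ FinSeq alphabet) (hP : P ⊆ FinSeq alphabet)
    (hfin : P.Finite) (hne : P.Nonempty) (hvP : ∀ u ∈ P, PInit v u)
    (hanti : ∀ u ∈ P, ∀ w ∈ P, ¬ PInit u w) :
    logCreature v P ∈ logCreatures ∧ IsTreeCreatureAt alphabet v (logCreature v P) := by
  have h : IsTreeCreatureAt alphabet v (logCreature v P) := by
    refine ⟨⟨Nat.cast_nonneg _, (singleton_nonempty v).prod hne, ?_⟩, ?_, ?_⟩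
    · rintro ⟨w, u⟩ ⟨hw, hu⟩
      obtain rfl : w = v := hw
      exact ⟨hv, hP hu, hvP u hu⟩
    · rintro ⟨w, u⟩ ⟨hw, -⟩
      exact hw
    · rwa [rng_logCreature]
  exact ⟨⟨(finite_singleton v).prod hfin, ⟨v, h⟩, by rw [rng_logCreature]; rfl⟩, h⟩

theorem alphabet_nontrivial (n : ℕ) : (alphabet n).Nontrivial := by
  have h : 1 < growth n ^ (n + 1) := Nat.one_lt_pow (by omega) (one_lt_growth n)
  exact ⟨0, by simp only [alphabet, mem_Iio]; omega, 1, h, by omega⟩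

theorem isTreeCreatingPair_log : IsTreeCreatingPair alphabet logCreatures logSig :=
  isTreeCreatingPair_fullSig alphabet_nontrivial fun _ ht => ht.2.1

theorem IsSystem.finite_log {T : Set (List ℕ)} {s : List ℕ → WeakCreature ℕ Unit}
    (hs : IsSystem alphabet logCreatures T s) : T.Finite :=
  finite_of_lim_eq_empty hs.quasiTree hs.wellFounded fun v hv =>
    hs.rng_eq v hv ▸ (hs.treeCreature v hv).finite_rng (hs.mem v hv).1

/-- A system is finite by König's lemma, and a creature is determined by its `val`, since the norm
is computed from the range and the parameter is trivial. -/
theorem stronglyFinitary_log : StronglyFinitary alphabet logCreatures logSig := by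
  refine ⟨fun n => finite_Iio _, fun t ht => ht.1, fun S _ _ => ?_⟩
  rcases (logSig S).eq_empty_or_nonempty with h | ⟨t₀, -, ⟨T, s, hs, rfl⟩, -⟩
  · rw [h]
    exact finite_empty
  · refine Set.Finite.of_finite_image (f := WeakCreature.val)
      ((hs.finite_log.prod hs.finite_log).finite_subsets.subset ?_) ?_
    · rintro _ ⟨t, ht, rfl⟩
      obtain ⟨-, r, hr, hrt, hrng⟩ := hs.mem_fullSig.1 ht
      rintro ⟨w, u⟩ hwu
      exact ⟨hrt.mem_val hwu ▸ hr.1, (hrng ⟨w, hwu⟩).1⟩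
    · rintro ⟨n, c, d⟩ ht ⟨n', c', d'⟩ ht' (rfl : c = c')
      have h := ht.1.2.2
      have h' := ht'.1.2.2
      simp only [WeakCreature.rng] at h h'
      rw [h, h']

/-- Pigeonhole at the place that realizes the norm: one of the two parts has at least half of the
values, and halving costs at most one unit because `growth m ≥ 2`. -/
theorem isBig_log : IsBig 2 logCreatures logSig := by
  classical
  intro t ht hnor h
  obtain ⟨hfin, ⟨v, hv⟩, ht'⟩ := id ht
  have hPfin := hv.finite_rng hfin
  rw [ht'] at hnor ⊢
  have hk : 1 < logNorm t.rng := by exact_mod_cast hnor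
  obtain ⟨m, hm⟩ := exists_le_ncard_vals hPfin hk.le le_rfl
  obtain ⟨k, hk'⟩ : ∃ k, logNorm t.rng = k + 1 := ⟨logNorm t.rng - 1, by omega⟩
  rw [hk'] at hm ⊢
  let R : Fin 2 → Set (List ℕ) := fun i => {w ∈ t.rng | h w = i}
  have hR : ∀ i, R i ⊆ t.rng := fun i w hw => hw.1
  obtain ⟨i, hi⟩ : ∃ i, growth m ^ k ≤ (vals m (R i)).ncard := by
    by_contra! hlt
    have hsub : vals m t.rng ⊆ vals m (R 0) ∪ vals m (R 1) := by
      rintro x ⟨w, hw, hx⟩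
      rcases Fin.exists_fin_two.1 ⟨h w, rfl⟩ with e | e
      · exact .inl ⟨w, ⟨hw, e⟩, hx⟩
      · exact .inr ⟨w, ⟨hw, e⟩, hx⟩
    have h1 := (ncard_le_ncard hsub ((vals_finite (hPfin.subset (hR 0)) m).union
      (vals_finite (hPfin.subset (hR 1)) m))).trans (ncard_union_le _ _)
    have h2 := hlt 0
    have h3 := hlt 1
    have h4 : growth m ^ k * 2 ≤ growth m ^ (k + 1) :=
      Nat.mul_le_mul_left _ (one_lt_growth m)
    omega
  have hRne : (R i).Nonempty := by
    have : 0 < (vals m (R i)).ncard := (Nat.pow_pos (zero_lt_one.trans (one_lt_growth m))).trans_le hi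
    obtain ⟨x, w, hw, -⟩ := nonempty_of_ncard_ne_zero this.ne'
    exact ⟨w, hw⟩
  obtain ⟨hc, hc'⟩ := logCreature_spec hv.base_mem ((hR i).trans hv.rng_subset)
    (hPfin.subset (hR i)) hRne (fun u hu => hv.pInit hu.1)
    fun u hu w hw => hv.2.2 u hu.1 w hw.1
  refine ⟨_, (mem_fullSig_singleton ht hv).2 ⟨hc, hc', ?_⟩, ?_, ?_⟩
  · rw [rng_logCreature]
    exact hR i
  · rw [rng_logCreature]
    exact fun u hu w hw => hu.2.trans hw.2.symm
  · have := le_logNorm (hPfin.subset (hR i)) hi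
    simp only [logCreature]
    push_cast
    rw [add_sub_cancel_right]
    exact_mod_cast this

/-- From a system one may compose creatures with any nonempty set of maximal points as range. -/
theorem IsSystem.logCreature_mem {T : Set (List ℕ)} {s : List ℕ → WeakCreature ℕ Unit}
    (hs : IsSystem alphabet logCreatures T s) {v : List ℕ} (hv : v ∈ hat T) (hP : P ⊆ maxPts T)
    (hne : P.Nonempty) : ∃ r, logCreature r P ∈ logSig (s '' hat T) := by
  obtain ⟨r, hr⟩ := hs.quasiTree
  have hrT := isRoot_hat hr hv
  obtain ⟨hc, hc'⟩ := logCreature_spec (hs.subset hr.1) (fun u hu => hs.subset (hP hu).1)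
    (hs.finite_log.subset fun u hu => (hP hu).1) hne
    (fun u hu => ⟨hr.2 u (hP hu).1, fun e => hrT.1.2 (e ▸ hP hu)⟩)
    fun u hu w hw => (mem_maxPts.1 (hP hu)).2 w (hP hw).1
  exact ⟨r, hs.mem_fullSig.2 ⟨hc, r, hr, hc', by rwa [rng_logCreature]⟩⟩

/-- Transplanting the range of `s v` to the root leaves the norm unchanged, as the norm depends on
the range alone. -/
theorem tOmittory_log : TOmittory alphabet logCreatures logSig := by
  intro T s hs v hv hmax
  obtain ⟨r, hr⟩ := hs.logCreature_mem hv hmax (hs.treeCreature v hv).rng_nonempty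
  refine ⟨_, hr, ?_, (rng_logCreature _ _).subset⟩
  rw [(hs.mem v hv).2.2]
  simp [logCreature]

theorem IsSystem.exists_mem_maxPts {T : Set (List ℕ)} {s : List ℕ → WeakCreature ℕ Unit}
    (hs : IsSystem alphabet logCreatures T s) {v : List ℕ} (hv : v ∈ T) :
    ∃ u ∈ maxPts T, v <+: u := by
  obtain ⟨u, ⟨hu, hvu⟩, hmax⟩ := (hs.finite_log.subset
    (fun u hu => hu.1 : {u ∈ T | v <+: u} ⊆ T)).exists_maximalFor List.length _
      ⟨v, hv, List.prefix_rfl⟩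
  refine ⟨u, mem_maxPts.2 ⟨hu, fun w hw huw => ?_⟩, hvu⟩
  exact absurd (hmax ⟨hw, hvu.trans huw.1⟩ huw.length_lt.le) (not_le.2 huw.length_lt)

/-- Take all maximal points as the range. Every successor in the system extends to a maximal point,
so no value at any place is lost. -/
theorem gluing_log : Gluing alphabet logCreatures logSig := by
  rintro T s hs ⟨v, hv⟩
  have hne : (maxPts T).Nonempty := (hs.exists_mem_maxPts hv.1).imp fun _ h => h.1
  obtain ⟨r, hr⟩ := hs.logCreature_mem hv Subset.rfl hne
  refine ⟨_, hr, fun w hw => ?_⟩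
  have : logNorm (s w).rng ≤ logNorm (maxPts T) := by
    refine logNorm_mono (hs.finite_log.subset fun u hu => hu.1) (fun u hu => ?_)
      ((hs.treeCreature w hw).finite_rng (hs.mem w hw).1)
    rw [hs.rng_eq w hw] at hu
    exact hs.exists_mem_maxPts hu.1
  rw [(hs.mem w hw).2.2]
  simp only [logCreature, tsub_le_iff_right]
  exact_mod_cast this.trans (Nat.le_succ _)

/-- If all sets `G c`, for `c ∈ C`, have density at least `a` then the set of points that
belong to at least the `M`th part of them has density at least `a - 1 / M`. -/
theorem density_le_card_filter {ι : Type} (C : Finset ι) (hC : C.Nonempty) (G : ι → Finset ℕ)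
    (N M : ℕ) (hM : 0 < M) (a : ℝ) (hG : ∀ c ∈ C, G c ⊆ Finset.range N ∧ a * N ≤ (G c).card) :
    (a - 1 / M) * N ≤
      ({i ∈ Finset.range N | C.card ≤ M * {c ∈ C | i ∈ G c}.card}.card : ℝ) := by
  set good := {i ∈ Finset.range N | C.card ≤ M * {c ∈ C | i ∈ G c}.card} with hgood
  have hcount : ∑ c ∈ C, (G c).card = ∑ i ∈ Finset.range N, {c ∈ C | i ∈ G c}.card := by
    have : ∀ c ∈ C, (G c).card = ∑ i ∈ Finset.range N, if i ∈ G c then 1 else 0 := fun c hc => by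
      rw [← Finset.card_filter]
      congr 1
      ext i
      simp only [Finset.mem_filter]
      exact ⟨fun h => ⟨(hG c hc).1 h, h⟩, fun h => h.2⟩
    rw [Finset.sum_congr rfl this, Finset.sum_comm]
    simp only [Finset.card_filter]
  -- Double counting of the pairs `i ∈ G c`: a point outside `good` contributes less than `C.card /
  -- M`, a good one at most `C.card`.
  have hpt : ∀ i ∈ Finset.range N, ({c ∈ C | i ∈ G c}.card : ℝ) ≤
      (if i ∈ good then (C.card : ℝ) else 0) + C.card / M := by
    intro i hi
    have hM' : (0 : ℝ) < M := by exact_mod_cast hM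
    split_ifs with h
    · have : ({c ∈ C | i ∈ G c}.card : ℝ) ≤ C.card := by
        exact_mod_cast Finset.card_filter_le _ _
      have : (0 : ℝ) ≤ C.card / M := by positivity
      linarith
    · rw [zero_add, le_div_iff₀ hM']
      have : M * {c ∈ C | i ∈ G c}.card < C.card := by
        by_contra! h'
        exact h (Finset.mem_filter.2 ⟨hi, h'⟩)
      rw [mul_comm]
      exact_mod_cast this.le
  have h1 : (C.card : ℝ) * (a * N) ≤ good.card * C.card + N * (C.card / M) := by
    calc (C.card : ℝ) * (a * N) = ∑ c ∈ C, a * N := by simp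
      _ ≤ ∑ c ∈ C, ((G c).card : ℝ) := Finset.sum_le_sum fun c hc => (hG c hc).2
      _ = ∑ i ∈ Finset.range N, ({c ∈ C | i ∈ G c}.card : ℝ) := by exact_mod_cast hcount
      _ ≤ ∑ i ∈ Finset.range N, ((if i ∈ good then (C.card : ℝ) else 0) + C.card / M) :=
        Finset.sum_le_sum hpt
      _ = good.card * C.card + N * (C.card / M) := by
        rw [Finset.sum_add_distrib, ← Finset.sum_filter]
        have : {i ∈ Finset.range N | i ∈ good} = good := by
          ext i
          simp [hgood]
        simp [this]
  have hC' : (0 : ℝ) < C.card := by exact_mod_cast hC.card_pos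
  refine le_of_mul_le_mul_left ?_ hC'
  calc (C.card : ℝ) * ((a - 1 / M) * N) = C.card * (a * N) - N * (C.card / M) := by ring
    _ ≤ C.card * good.card := by linarith

/-- By averaging, all but a loss of density `1 / growth m` of the points `i` belong to at least the
`growth m`th part of the sets; keeping that part costs one unit of the norm. -/
theorem nnpType_log : NNPType alphabet logCreatures logSig := by
  classical
  -- Consecutive terms differ by `(1 / 2) ^ (n + 3)`, which bounds `1 / growth m` for every place `m
  -- ≥ n`.
  refine ⟨fun n => 1 / 2 - (1 / 2) ^ (n + 2), fun n => n, ?_, strictMono_id, fun n => ⟨?_, ?_⟩,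
    ⟨1 / 2, by norm_num, ?_⟩, ?_⟩
  · refine strictMono_nat_of_lt_succ fun n => ?_
    have : (0 : ℝ) < (1 / 2) ^ n := by positivity
    simp only [pow_succ]
    linarith
  · have : (1 / 2 : ℝ) ^ n ≤ 1 := pow_le_one₀ (by norm_num) (by norm_num)
    simp only [pow_succ]
    linarith
  · have : (0 : ℝ) < (1 / 2) ^ (n + 2) := by positivity
    linarith
  · have h := (tendsto_pow_atTop_nhds_zero_of_lt_one (r := (1 / 2 : ℝ)) (by norm_num)
      (by norm_num)).comp (tendsto_add_atTop_nat 2)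
    simpa only [Function.comp_def, sub_zero] using h.const_sub (1 / 2)
  intro n t ht hnor v hvt (hnv : n ≤ v.length) N g hg
  obtain ⟨hfin, ⟨v', hv⟩, ht'⟩ := id ht
  rw [basis_fullSig ht hv] at hvt
  obtain rfl : v = v' := hvt
  rw [pos_fullSig ht hv] at hg
  have hPfin := hv.finite_rng hfin
  have hk : 2 < logNorm t.rng := by
    rw [ht'] at hnor
    exact_mod_cast hnor
  obtain ⟨m, hm⟩ := exists_le_ncard_vals hPfin (by omega) (le_refl (logNorm t.rng))
  obtain ⟨k, hk'⟩ : ∃ k, logNorm t.rng = k + 1 := ⟨logNorm t.rng - 1, by omega⟩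
  rw [hk'] at hm
  have hm1 : 1 < growth m ^ (k + 1) := Nat.one_lt_pow (by omega) (one_lt_growth m)
  have hvm : v.length ≤ m :=
    length_le_of_one_lt_ncard_vals (fun w hw => (hv.pInit hw).1) (hm1.trans_le hm)
  -- One representative per value is enough: the norm counts values, not sequences.
  have hex : ∀ x ∈ vals m t.rng, ∃ w ∈ t.rng, w[m]? = some x := fun x hx => hx
  choose! w hw hwx using hex
  set C : Finset ℕ := (vals_finite hPfin m).toFinset with hC
  have hCcard : (vals m t.rng).ncard = C.card := ncard_eq_toFinset_card _ _
  have hCmem : ∀ x, x ∈ C ↔ x ∈ vals m t.rng := fun x => by simp [hC]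
  rw [hCcard] at hm
  have hCne : C.Nonempty := Finset.card_pos.1 (by omega)
  rcases Nat.eq_zero_or_pos N with rfl | hN
  · simp
  have hN' : (0 : ℝ) < N := by exact_mod_cast hN
  have hM : 0 < growth m := zero_lt_one.trans (one_lt_growth m)
  have key := density_le_card_filter C hCne (fun x => g (w x)) N (growth m) hM
    (1 / 2 - (1 / 2) ^ (n + 1 + 2)) fun x hx => by
      obtain ⟨h1, h2⟩ := hg (w x) (hw x ((hCmem x).1 hx))
      exact ⟨h1, by rwa [le_div_iff₀ hN'] at h2⟩
  have hbound : (1 / 2 - (1 / 2) ^ (n + 2) : ℝ) ≤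
      1 / 2 - (1 / 2) ^ (n + 1 + 2) - 1 / growth m := by
    have : (1 / growth m : ℝ) ≤ (1 / 2) ^ (n + 3) := by
      rw [growth, Nat.cast_pow, Nat.cast_ofNat, ← one_div_pow]
      exact pow_le_pow_of_le_one (by norm_num) (by norm_num) (by omega)
    have h2 : (1 / 2 : ℝ) ^ (n + 2) = 2 * (1 / 2) ^ (n + 3) := by ring
    have h3 : (1 / 2 : ℝ) ^ (n + 1 + 2) = (1 / 2) ^ (n + 3) := by ring
    linarith
  refine ((mul_comm _ _).le.trans (mul_le_mul_of_nonneg_right hbound hN'.le)).trans (key.trans ?_)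
  rw [← ncard_coe_finset]
  refine Nat.cast_le.2 (ncard_le_ncard (fun i hi => ?_)
    ((finite_lt_nat N).subset fun i hi => hi.1))
  obtain ⟨hiN, hi⟩ := Finset.mem_filter.1 (Finset.mem_coe.1 hi)
  refine ⟨Finset.mem_range.1 hiN, ?_⟩
  set R : Set (List ℕ) := w '' ({x ∈ C | i ∈ g (w x)} : Finset ℕ) with hR
  have hRP : R ⊆ t.rng := by
    rintro _ ⟨x, hx, rfl⟩
    exact hw x ((hCmem x).1 (Finset.mem_filter.1 (Finset.mem_coe.1 hx)).1)
  have hRcard : growth m ^ k ≤ (vals m R).ncard := by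
    have h1 : {x ∈ C | i ∈ g (w x)}.card ≤ (vals m R).ncard := by
      rw [← ncard_coe_finset]
      refine ncard_le_ncard (fun x hx => ⟨w x, ⟨x, hx, rfl⟩, hwx x ((hCmem x).1
        (Finset.mem_filter.1 (Finset.mem_coe.1 hx)).1)⟩) (vals_finite (hPfin.subset hRP) m)
    have h2 : growth m * growth m ^ k ≤ growth m * {x ∈ C | i ∈ g (w x)}.card := by
      rw [← pow_succ']
      exact hm.trans hi
    exact (Nat.le_of_mul_le_mul_left h2 hM).trans h1
  have hRne : R.Nonempty := by
    have : 0 < (vals m R).ncard := (Nat.pow_pos hM).trans_le hRcard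
    obtain ⟨x, u, hu, -⟩ := nonempty_of_ncard_ne_zero this.ne'
    exact ⟨u, hu⟩
  obtain ⟨hc, hc'⟩ := logCreature_spec hv.base_mem (hRP.trans hv.rng_subset)
    (hPfin.subset hRP) hRne (fun u hu => hv.pInit (hRP hu))
    fun u hu w hw => hv.2.2 u (hRP hu) w (hRP hw)
  refine ⟨_, (mem_fullSig_singleton ht hv).2 ⟨hc, hc', (rng_logCreature _ _).subset.trans hRP⟩,
    ?_, ?_, ?_⟩
  · have := le_logNorm (hPfin.subset hRP) hRcard
    rw [ht', hk']
    simp only [logCreature]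
    push_cast
    rw [add_sub_cancel_right]
    exact_mod_cast this
  · rw [basis_fullSig ht hv, basis_fullSig hc hc']
  · rw [pos_fullSig hc hc', rng_logCreature]
    rintro _ ⟨x, hx, rfl⟩
    exact (Finset.mem_filter.1 (Finset.mem_coe.1 hx)).2

/-- The identity serves as `f`: norm above `1` gives a place `m` with at least `growth m > m`
values. -/
theorem stronglyViolatesSacks_log : StronglyViolatesSacks alphabet logCreatures logSig := by
  refine ⟨id, monotone_id, fun m => ⟨m + 1, by simp⟩, fun t ht hnor u hut => ?_⟩
  obtain ⟨hfin, ⟨v, hv⟩, ht'⟩ := id ht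
  rw [basis_fullSig ht hv] at hut
  obtain rfl : u = v := hut
  rw [pos_fullSig ht hv]
  have hPfin := hv.finite_rng hfin
  have hk : 1 < logNorm t.rng := by
    rw [ht'] at hnor
    exact_mod_cast hnor
  obtain ⟨m, hm⟩ := exists_le_ncard_vals hPfin le_rfl hk.le
  rw [pow_one] at hm
  refine ⟨m, length_le_of_one_lt_ncard_vals (fun w hw => (hv.pInit hw).1)
    ((one_lt_growth m).trans_le hm), ?_⟩
  have hset : {x : ℕ | ∃ w ∈ t.rng, ∃ hn : m < w.length, w[m] = x} = vals m t.rng := by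
    ext x
    simp [vals, List.getElem?_eq_some_iff]
  rw [hset, ← (vals_finite hPfin m).cast_ncard_eq]
  exact_mod_cast (lt_growth m).trans_le hm

end LogNorm

/-! ### The forcing notions determined by creatures with the logarithmic norm -/

/-- The forcing notions determined by creatures with the logarithmic norm. -/
abbrev LogForcing (e : Fin 5) : Type := TreeForcing alphabet logCreatures logSig e

section LogForcing

variable {e : Fin 5}

theorem TreeForcing.finite_suc (p : LogForcing e) {v : List ℕ} (hv : v ∈ p.T) :
    (suc p.T v).Finite :=
  p.rng_eq v hv ▸ (p.treeCreature v hv).finite_rng (p.mem v hv).1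

theorem TreeForcing.nor_eq (p : LogForcing e) {v : List ℕ} (hv : v ∈ p.T) :
    (p.t v).nor = logNorm (suc p.T v) := by
  rw [(p.mem v hv).2.2, p.rng_eq v hv]

theorem TreeForcing.exists_pInit (p : LogForcing e) {v : List ℕ} (hv : v ∈ p.T) :
    ∃ u ∈ p.T, PInit v u := by
  by_contra! h
  exact (p.no_max ▸ mem_maxPts.2 ⟨hv, h⟩ : v ∈ (∅ : Set (List ℕ)))

/-- Composition being unrestricted, it suffices to find inside `p.T` a well founded tree with root
`v` among whose maximal points are all successors of `v` in `q.T`. -/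
theorem TreeForcing.le_iff {p q : LogForcing e} : p ≤ q ↔ q.T ⊆ p.T := by
  refine ⟨fun h => h.1, fun h => ⟨h, fun v hv => ?_⟩⟩
  have hw : ∀ w ∈ suc q.T v, w ∈ p.T ∧ PInit v w := fun w hw => ⟨h hw.1, hw.2.1⟩
  -- Follow `p.T` from `v` upwards and stop as soon as the point is no longer properly below a
  -- successor of `v` in `q.T`. Finitely many successors bound the lengths of the points that are
  -- continued, hence well-foundedness.
  set T₀ : Set (List ℕ) :=
    {z ∈ p.T | v <+: z ∧ ∀ y ∈ p.T, v <+: y → PInit y z → ∃ w ∈ suc q.T v, PInit y w} with hT₀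
  have hroot : IsRoot T₀ v := ⟨⟨h hv, List.prefix_rfl, fun y _ hvy hyv =>
    (pInit_irrefl v (PInit.prefix_trans hvy hyv)).elim⟩, fun z hz => hz.2.1⟩
  have hsuc : ∀ y ∈ hat T₀, suc T₀ y = suc p.T y := by
    intro y hy
    obtain ⟨hyT, z, hz, hyz⟩ := mem_hat.1 hy
    obtain ⟨w, hw', hyw⟩ := hz.2.2 y hyT.1 hyT.2.1 hyz
    ext u
    constructor
    · rintro ⟨hu, hyu, hmin⟩
      refine ⟨hu.1, hyu, fun ⟨x, hx, hyx, hxu⟩ => hmin ⟨x, ⟨hx, hyT.2.1.trans hyx.1, ?_⟩, hyx, hxu⟩⟩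
      exact fun y' hy' hvy' hyx' => hu.2.2 y' hy' hvy' (hyx'.trans hxu)
    · rintro ⟨hu, hyu, hmin⟩
      refine ⟨⟨hu, hyT.2.1.trans hyu.1, fun y' hy' _ hyu' => ⟨w, hw', ?_⟩⟩, hyu,
        fun ⟨x, hx, hx'⟩ => hmin ⟨x, hx.1, hx'⟩⟩
      rcases prefix_or_pInit hyu'.1 hyu.1 with h' | h'
      · exact PInit.prefix_trans h' hyw
      · exact absurd ⟨y', hy', h', hyu'⟩ hmin
  have hsys : IsSystem alphabet logCreatures T₀ p.t := by
    refine ⟨fun z hz => p.subset hz.1, ⟨v, hroot⟩, ?_, fun y hy => p.mem y hy.1.1,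
      fun y hy => p.treeCreature y hy.1.1, fun y hy => (p.rng_eq y hy.1.1).trans (hsuc y hy).symm⟩
    refine eq_empty_of_forall_notMem fun x hx => ?_
    obtain ⟨b, hb⟩ := ((q.finite_suc hv).image List.length).bddAbove
    obtain ⟨n, hn, hnT⟩ := hx b
    obtain ⟨m, hm, hmT⟩ := hx n
    obtain ⟨w, hw', hxw⟩ := hmT.2.2 _ hnT.1 hnT.2.1 (restr_pInit x hm)
    have h1 := hb (mem_image_of_mem List.length hw')
    have h2 := hxw.length_lt
    rw [length_restr] at h2
    omega
  refine ⟨T₀, fun u hu => ⟨hu.1, hu.2.1⟩, hsys, hsys.mem_fullSig.2 ⟨q.mem v hv, v, hroot,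
    q.treeCreature v hv, ?_⟩⟩
  rw [q.rng_eq v hv]
  intro w hw'
  refine mem_maxPts.2 ⟨⟨h hw'.1, hw'.2.1.1, fun y _ _ hyw => ⟨w, hw', hyw⟩⟩, fun z hz hwz => ?_⟩
  obtain ⟨w₁, hw₁, hww₁⟩ := hz.2.2 w (h hw'.1) hw'.2.1.1 hwz
  exact not_pInit_of_mem_suc hw' hw₁ hww₁

theorem TreeForcing.refl (p : LogForcing e) : p ≤ p := le_iff.2 Subset.rfl

theorem TreeForcing.trans {p q r : LogForcing e} (h : p ≤ q) (h' : q ≤ r) : p ≤ r :=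
  le_iff.2 ((le_iff.1 h').trans (le_iff.1 h))

instance : Preorder (LogForcing e) where
  le_refl := TreeForcing.refl
  le_trans _ _ _ := TreeForcing.trans

/-- A finitely branching quasi tree without maximal points such that the norms at long
sequences are large determines a condition. -/
theorem TreeForcing.exists_of_tree {T : Set (List ℕ)} (hT : T ⊆ FinSeq alphabet)
    (hroot : IsQuasiTree T) (hmax : maxPts T = ∅) (hfin : ∀ v ∈ T, (suc T v).Finite)
    (hnor : ∀ n, ∃ l, ∀ v ∈ T, l ≤ v.length → n ≤ logNorm (suc T v)) :
    ∃ p : LogForcing e, p.T = T ∧ NormCondition p.T p.t 4 := by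
  have hspec : ∀ v ∈ T, logCreature v (suc T v) ∈ logCreatures ∧
      IsTreeCreatureAt alphabet v (logCreature v (suc T v)) := by
    refine fun v hv => logCreature_spec (hT hv) (fun u hu => hT hu.1) (hfin v hv) ?_
      (fun u hu => hu.2.1) fun u hu w hw => not_pInit_of_mem_suc hu hw
    by_contra hne
    refine (hmax ▸ mem_maxPts.2 ⟨hv, fun u hu hvu => hne ?_⟩ : v ∈ (∅ : Set (List ℕ)))
    exact (exists_suc_prefix hu hvu).imp fun w hw => hw.1
  have hnorm : NormCondition T (fun v => logCreature v (suc T v)) 4 := by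
    refine normCondition_four hmax fun n => ?_
    obtain ⟨l, hl⟩ := hnor n
    refine ⟨{v ∈ T | l ≤ v.length}, fun v hv => hv.1, fun x hx => ?_, fun v hv u hu hvu => ?_⟩
    · obtain ⟨k, hk, hkT⟩ := hx l
      exact ⟨k, hkT, by simpa using hk.le⟩
    · exact Nat.cast_le.2 (hl u hu (hv.2.trans hvu.length_lt.le))
  exact ⟨⟨T, fun v => logCreature v (suc T v), hT, hroot, hmax, fun v hv => (hspec v hv).1,
    fun v hv => (hspec v hv).2, fun v _ => rng_logCreature _ _,
    normCondition_of_four hmax hnorm e⟩, rfl, hnorm⟩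

/-- The root of a condition. -/
noncomputable def TreeForcing.root (p : LogForcing e) : List ℕ := p.quasiTree.choose

theorem TreeForcing.isRoot (p : LogForcing e) : IsRoot p.T p.root := p.quasiTree.choose_spec

theorem TreeForcing.root_mem (p : LogForcing e) : p.root ∈ p.T := p.isRoot.1

theorem TreeForcing.root_prefix {p q : LogForcing e} (h : p ≤ q) : p.root <+: q.root :=
  p.isRoot.2 _ (le_iff.1 h q.root_mem)

theorem TreeForcing.exists_cone (p : LogForcing e) {z : List ℕ} (hz : z ∈ p.T) :
    ∃ q : LogForcing e, q.T = {y ∈ p.T | z <+: y} := by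
  set T : Set (List ℕ) := {y ∈ p.T | z <+: y} with hT
  have hmax : maxPts T = ∅ := eq_empty_of_forall_notMem fun v hv => by
    obtain ⟨u, hu, hvu⟩ := p.exists_pInit hv.1.1
    exact hv.2 ⟨u, ⟨hu, hv.1.2.trans hvu.1⟩, hvu⟩
  have hsuc : ∀ v ∈ T, suc p.T v = suc T v := by
    intro v hv
    ext u
    constructor
    · rintro ⟨hu, hvu, hmin⟩
      exact ⟨⟨hu, hv.2.trans hvu.1⟩, hvu, fun ⟨w, hw, hw'⟩ => hmin ⟨w, hw.1, hw'⟩⟩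
    · rintro ⟨hu, hvu, hmin⟩
      exact ⟨hu.1, hvu, fun ⟨w, hw, hw'⟩ => hmin ⟨w, ⟨hw, hv.2.trans hw'.1.1⟩, hw'⟩⟩
  have hlim : lim T ⊆ lim p.T := fun x hx m => (hx m).imp fun n hn => ⟨hn.1, hn.2.1⟩
  have hlim' : ∀ x ∈ lim T, ∀ k, z.length ≤ k → z <+: restr x k := by
    intro x hx k hk
    obtain ⟨n, hn, hnT⟩ := hx z.length
    rw [eq_restr_of_prefix hnT.2]
    exact restr_prefix x hk
  refine ⟨⟨T, p.t, fun v hv => p.subset hv.1, ⟨z, ⟨hz, List.prefix_rfl⟩, fun u hu => hu.2⟩, hmax,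
    fun v hv => p.mem v hv.1, fun v hv => p.treeCreature v hv.1,
    fun v hv => (p.rng_eq v hv.1).trans (hsuc v hv), ?_⟩, rfl⟩
  have hnorm := p.norm
  fin_cases e
  · intro x hx b m
    obtain ⟨k, hk, hkT, hb⟩ := hnorm x (hlim hx) b (max m z.length)
    exact ⟨k, by omega, ⟨hkT, hlim' x hx k (by omega)⟩, hb⟩
  · intro x hx b
    obtain ⟨m, hm⟩ := hnorm x (hlim hx) b
    exact ⟨m, fun k hk hkT => hm k hk hkT.1⟩
  · intro s hs n
    obtain ⟨v, hv, hsv, hn⟩ := hnorm s hs.1 n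
    exact ⟨v, ⟨hv, hs.2.trans hsv.1⟩, hsv, hn⟩
  · intro s hs n
    obtain ⟨v, hv, hsv, hn⟩ := hnorm s hs.1 n
    exact ⟨v, ⟨hv, hs.2.trans hsv.1⟩, hsv, fun u hu => hn u hu.1⟩
  -- The front of `p` may meet a branch below `z`, outside the cone; the points of the cone above
  -- the front still form a bar.
  · refine normCondition_four hmax fun n => ?_
    obtain ⟨F, hF, hn⟩ := hnorm n
    refine ⟨{y ∈ T | ∃ v ∈ F, v <+: y}, fun y hy => hy.1, fun x hx => ?_,
      fun y ⟨_, v, hv, hvy⟩ u hu hyu => hn v hv u hu.1 (PInit.prefix_trans hvy hyu)⟩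
    obtain ⟨k, hk⟩ := hF.2.2.1 x (hlim hx)
    obtain ⟨n, hn, hnT⟩ := hx k
    exact ⟨n, hnT, _, hk, restr_prefix x hn.le⟩

/-- The part of the condition `p` above a point of its quasi tree. -/
noncomputable def TreeForcing.cone (p : LogForcing e) {z : List ℕ} (hz : z ∈ p.T) :
    LogForcing e := (p.exists_cone hz).choose

theorem TreeForcing.cone_T (p : LogForcing e) {z : List ℕ} (hz : z ∈ p.T) :
    (p.cone hz).T = {y ∈ p.T | z <+: y} := (p.exists_cone hz).choose_spec

theorem TreeForcing.le_cone (p : LogForcing e) {z : List ℕ} (hz : z ∈ p.T) : p ≤ p.cone hz :=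
  le_iff.2 (p.cone_T hz ▸ fun _ h => h.1)

theorem TreeForcing.root_cone (p : LogForcing e) {z : List ℕ} (hz : z ∈ p.T) :
    (p.cone hz).root = z :=
  (p.cone hz).isRoot.unique (p.cone_T hz ▸ ⟨⟨hz, List.prefix_rfl⟩, fun _ h => h.2⟩)

theorem TreeForcing.exists_le_logNorm (p : LogForcing e) {v : List ℕ} (hv : v ∈ p.T) (n : ℕ) :
    ∃ u ∈ p.T, PInit v u ∧ n ≤ logNorm (suc p.T u) := by
  obtain ⟨u, hu, hvu, hn⟩ := normCondition_two p.no_max p.norm v hv n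
  rw [p.nor_eq hu] at hn
  exact ⟨u, hu, hvu, by exact_mod_cast hn⟩

/-! ### Splitting families of conditions -/

/-- `F` is a finite family of conditions stronger than `r` whose roots take at least
`growth m ^ n` different values at place `m`. -/
structure IsSplit (n m : ℕ) (r : LogForcing e) (F : Finset (LogForcing e)) : Prop where
  le : ∀ c ∈ F, r ≤ c
  length_le : r.root.length ≤ m
  lt_length : ∀ c ∈ F, m < c.root.length
  injOn : ∀ c ∈ F, ∀ d ∈ F, c.root[m]? = d.root[m]? → c = d
  le_card : growth m ^ n ≤ F.card

/-- Go to a point of large norm above the root and take, for each value at the place realizing the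
norm, the cone of one successor with that value. -/
theorem exists_isSplit (r : LogForcing e) (n : ℕ) : ∃ m F, IsSplit n m r F := by
  classical
  -- The exponent `n + 1` guarantees at least two values even for `n = 0`, which forces the place to
  -- lie beyond the root.
  obtain ⟨v, hv, hrv, hn⟩ := r.exists_le_logNorm r.root_mem (n + 1)
  obtain ⟨m, hm⟩ := exists_le_ncard_vals (r.finite_suc hv) (Nat.le_add_left 1 n) hn
  have hfin := vals_finite (r.finite_suc hv) m
  have hex : ∀ x : vals m (suc r.T v), ∃ c : LogForcing e, r ≤ c ∧ c.root[m]? = some x.1 := by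
    rintro ⟨x, w, hw, hx⟩
    exact ⟨r.cone hw.1, r.le_cone hw.1, by rw [r.root_cone]; exact hx⟩
  choose c hc hcx using hex
  have : Fintype (vals m (suc r.T v)) := hfin.fintype
  have hinj : Function.Injective c := fun x y h => by
    have := (hcx x).symm.trans ((congrArg (fun p : LogForcing e => p.root[m]?) h).trans (hcx y))
    exact Subtype.ext (Option.some_injective _ this)
  refine ⟨m, Finset.univ.image c, ?_, ?_, ?_, ?_, ?_⟩
  · intro d hd
    obtain ⟨x, -, rfl⟩ := Finset.mem_image.1 hd
    exact hc x
  · have h1 : 1 < growth m ^ (n + 1) := Nat.one_lt_pow (by omega) (one_lt_growth m)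
    exact hrv.length_lt.le.trans
      (length_le_of_one_lt_ncard_vals (fun w hw => hw.2.1.1) (h1.trans_le hm))
  · intro d hd
    obtain ⟨x, -, rfl⟩ := Finset.mem_image.1 hd
    exact (List.getElem?_eq_some_iff.1 (hcx x)).1
  · intro d hd d' hd' h
    obtain ⟨x, -, rfl⟩ := Finset.mem_image.1 hd
    obtain ⟨y, -, rfl⟩ := Finset.mem_image.1 hd'
    rw [hcx, hcx] at h
    rw [Subtype.ext (Option.some_injective _ h)]
  · rw [Finset.card_image_of_injective _ hinj, Finset.card_univ, ← Nat.card_eq_fintype_card]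
    exact (Nat.pow_le_pow_right (zero_lt_one.trans (one_lt_growth m)) (Nat.le_succ n)).trans hm

variable {n m : ℕ} {r : LogForcing e} {F : Finset (LogForcing e)}

theorem IsSplit.pInit (h : IsSplit n m r F) {c : LogForcing e} (hc : c ∈ F) :
    PInit r.root c.root :=
  .of_length_lt (TreeForcing.root_prefix (h.le c hc)) (h.length_le.trans_lt (h.lt_length c hc))

theorem IsSplit.nonempty (h : IsSplit n m r F) : F.Nonempty :=
  Finset.card_pos.1 ((Nat.pow_pos (zero_lt_one.trans (one_lt_growth m))).trans_le h.le_card)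

theorem IsSplit.eq_of_prefix (h : IsSplit n m r F) {c d : LogForcing e} (hc : c ∈ F) (hd : d ∈ F)
    {w : List ℕ} (hcw : c.root <+: w) (hdw : d.root <+: w) : c = d := by
  refine h.injOn c hc d hd ?_
  have hm := h.lt_length c hc
  have hm' := h.lt_length d hd
  rw [List.getElem?_eq_getElem hm, List.getElem?_eq_getElem hm', hcw.getElem, hdw.getElem]

open Classical in
/-- The members of a splitting family may be replaced by stronger conditions. -/
theorem IsSplit.image (h : IsSplit n m r F) (f : LogForcing e → LogForcing e)
    (hf : ∀ c ∈ F, c ≤ f c) : IsSplit n m r (F.image f) := by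
  have hm : ∀ c ∈ F, m < (f c).root.length := fun c hc =>
    (h.lt_length c hc).trans_le (TreeForcing.root_prefix (hf c hc)).length_le
  have hval : ∀ c ∈ F, (f c).root[m]? = c.root[m]? := fun c hc => by
    rw [List.getElem?_eq_getElem (h.lt_length c hc), List.getElem?_eq_getElem (hm c hc),
      (TreeForcing.root_prefix (hf c hc)).getElem]
  refine ⟨?_, h.length_le, ?_, ?_, ?_⟩
  · simpa using fun c hc => (h.le c hc).trans (hf c hc)
  · simpa using hm
  · intro d hd d' hd' hdd
    obtain ⟨c, hc, rfl⟩ := Finset.mem_image.1 hd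
    obtain ⟨c', hc', rfl⟩ := Finset.mem_image.1 hd'
    rw [hval c hc, hval c' hc'] at hdd
    rw [h.injOn c hc c' hc' hdd]
  · rw [Finset.card_image_of_injOn]
    · exact h.le_card
    · intro c hc c' hc' hcc
      exact h.injOn c hc c' hc' (by rw [← hval c hc, ← hval c' hc', hcc])

/-- At the cost of one unit of the norm one may pass to a part of a splitting family. -/
theorem IsSplit.subset (h : IsSplit (n + 1) m r F) {F' : Finset (LogForcing e)} (hF' : F' ⊆ F)
    (hcard : F.card ≤ growth m * F'.card) : IsSplit n m r F' where
  le c hc := h.le c (hF' hc)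
  length_le := h.length_le
  lt_length c hc := h.lt_length c (hF' hc)
  injOn c hc d hd := h.injOn c (hF' hc) d (hF' hd)
  le_card := Nat.le_of_mul_le_mul_left (by rw [← pow_succ']; exact h.le_card.trans hcard)
    (zero_lt_one.trans (one_lt_growth m))

/-- Splitting families may be chosen inside dense sets. -/
theorem exists_isSplit_of_dense (r : LogForcing e) (n : ℕ) {D : LogForcing e → Prop}
    (hD : ∀ c, r ≤ c → ∃ d, c ≤ d ∧ D d) : ∃ m F, IsSplit n m r F ∧ ∀ c ∈ F, D c := by
  classical
  obtain ⟨m, F, hF⟩ := exists_isSplit r n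
  choose! f hf using hD
  exact ⟨m, F.image f, hF.image f fun c hc => (hf c (hF.le c hc)).1,
    by simpa using fun c hc => (hf c (hF.le c hc)).2⟩

/-! ### Fusion -/

/-- The property `I n` is an invariant of level `n`. The new quasi tree consists only of the roots
of the chosen conditions; their own trees serve for the compatibility statement. -/
theorem fusion (I : ℕ → LogForcing e → Prop) {p : LogForcing e} (hp : I 0 p)
    (hI : ∀ n r, I n r → ∃ m F, IsSplit n m r F ∧ ∀ c ∈ F, I (n + 1) c) :
    ∃ q, p ≤ q ∧ NormCondition q.T q.t 4 ∧ ∃ G : ℕ → Finset (LogForcing e), (∀ n, ∀ r ∈ G n, I n r) ∧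
      ∀ n q', q ≤ q' → ∃ r ∈ G n, Compat r q' := by
  classical
  choose! pl ch hsplit hch using hI
  let G : ℕ → Finset (LogForcing e) := fun n =>
    Nat.rec {p} (fun n G => G.biUnion (ch n)) n
  have hG0 : G 0 = {p} := rfl
  have hGs : ∀ n, G (n + 1) = (G n).biUnion (ch n) := fun n => rfl
  have hGI : ∀ n, ∀ r ∈ G n, I n r := by
    intro n
    induction n with
    | zero => simpa [hG0] using hp
    | succ n ih =>
      intro c hc
      rw [hGs, Finset.mem_biUnion] at hc
      obtain ⟨r, hr, hc⟩ := hc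
      exact hch n r (ih r hr) c hc
  have hparent : ∀ n, ∀ c ∈ G (n + 1), ∃ r ∈ G n, c ∈ ch n r := fun n c hc => by
    rwa [hGs, Finset.mem_biUnion] at hc
  have hchild : ∀ n, ∀ r ∈ G n, ∀ c ∈ ch n r, c ∈ G (n + 1) := fun n r hr c hc => by
    rw [hGs, Finset.mem_biUnion]
    exact ⟨r, hr, hc⟩
  have hanc : ∀ n k, n ≤ k → ∀ d ∈ G k, ∃ r ∈ G n, r ≤ d := by
    intro n k hnk
    induction k, hnk using Nat.le_induction with
    | base => exact fun d hd => ⟨d, hd, d.refl⟩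
    | succ k _ ih =>
      intro d hd
      obtain ⟨r, hr, hd⟩ := hparent k d hd
      obtain ⟨r', hr', hle⟩ := ih r hr
      exact ⟨r', hr', hle.trans ((hsplit k r (hGI k r hr)).le d hd)⟩
  -- Within a level, comparable roots belong to the same condition, because siblings differ at their
  -- splitting place. Hence ancestors can be identified from roots.
  have hanti : ∀ n, ∀ r ∈ G n, ∀ r' ∈ G n, ∀ w, r.root <+: w → r'.root <+: w → r = r' := by
    intro n
    induction n with
    | zero => simp [hG0]
    | succ n ih =>
      intro c hc c' hc' w hw hw'
      obtain ⟨r, hr, hc⟩ := hparent n c hc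
      obtain ⟨r', hr', hc'⟩ := hparent n c' hc'
      have hs := hsplit n r (hGI n r hr)
      obtain rfl := ih r hr r' hr' w ((hs.pInit hc).1.trans hw)
        (((hsplit n r' (hGI n r' hr')).pInit hc').1.trans hw')
      exact hs.eq_of_prefix hc hc' hw hw'
  have hdepth : ∀ n k, ∀ r ∈ G n, ∀ d ∈ G k, PInit r.root d.root → n < k := by
    intro n k r hr d hd h
    by_contra! hkn
    obtain ⟨d', hd', hle⟩ := hanc k n hkn r hr
    have h1 := TreeForcing.root_prefix hle
    rw [hanti k d' hd' d hd d.root (h1.trans h.1) List.prefix_rfl] at h1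
    exact pInit_irrefl _ (h.trans_prefix h1)
  have hmemT : ∀ n, ∀ r ∈ G n, ∀ k, ∀ d ∈ G k, r.root <+: d.root → d.root ∈ r.T := by
    intro n r hr k d hd h
    rcases le_or_gt n k with hnk | hkn
    · obtain ⟨r', hr', hle⟩ := hanc n k hnk d hd
      rw [hanti n r hr r' hr' d.root h (TreeForcing.root_prefix hle)]
      exact TreeForcing.le_iff.1 hle d.root_mem
    · obtain ⟨d', hd', hle⟩ := hanc k n hkn.le r hr
      have h1 := TreeForcing.root_prefix hle
      rw [hanti k d' hd' d hd d.root (h1.trans h) List.prefix_rfl] at h1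
      rw [prefix_antisymm h1 h]
      exact r.root_mem
  set S : Set (List ℕ) := {v | ∃ n, ∃ r ∈ G n, r.root = v} with hS
  have hsuc : ∀ n, ∀ r ∈ G n, suc S r.root = TreeForcing.root '' (ch n r : Set (LogForcing e)) := by
    intro n r hr
    have hs := hsplit n r (hGI n r hr)
    -- every point of `S` properly above the root of `r` is above the root of a child of `r`
    have habove : ∀ k, ∀ d ∈ G k, PInit r.root d.root → ∃ c ∈ ch n r, c ≤ d := by
      intro k d hd h
      obtain ⟨c, hc, hle⟩ := hanc (n + 1) k (hdepth n k r hr d hd h) d hd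
      obtain ⟨r', hr', hc'⟩ := hparent n c hc
      have h1 := ((hsplit n r' (hGI n r' hr')).pInit hc').1.trans (TreeForcing.root_prefix hle)
      rw [← hanti n r hr r' hr' d.root h.1 h1] at hc'
      exact ⟨c, hc', hle⟩
    ext v
    constructor
    · rintro ⟨⟨k, d, hd, rfl⟩, hrd, hmin⟩
      obtain ⟨c, hc, hle⟩ := habove k d hd hrd
      refine ⟨c, hc, (eq_or_pInit (TreeForcing.root_prefix hle)).resolve_right fun h => ?_⟩
      exact hmin ⟨c.root, ⟨n + 1, c, hchild n r hr c hc, rfl⟩, hs.pInit hc, h⟩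
    · rintro ⟨c, hc, rfl⟩
      refine ⟨⟨n + 1, c, hchild n r hr c hc, rfl⟩, hs.pInit hc, ?_⟩
      rintro ⟨_, ⟨k, d, hd, rfl⟩, hrd, hdc⟩
      obtain ⟨c', hc', hle⟩ := habove k d hd hrd
      have h1 := TreeForcing.root_prefix hle
      rw [hs.eq_of_prefix hc' hc (h1.trans hdc.1) List.prefix_rfl] at h1
      exact pInit_irrefl _ (hdc.trans_prefix h1)
  have hSp : S ⊆ p.T := by
    rintro _ ⟨n, r, hr, rfl⟩
    obtain ⟨p', hp', hle⟩ := hanc 0 n (Nat.zero_le n) r hr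
    rw [hG0, Finset.mem_singleton] at hp'
    exact TreeForcing.le_iff.1 (hp' ▸ hle) r.root_mem
  have hmax : maxPts S = ∅ := by
    refine eq_empty_of_forall_notMem ?_
    rintro _ ⟨⟨n, r, hr, rfl⟩, h⟩
    have hs := hsplit n r (hGI n r hr)
    obtain ⟨c, hc⟩ := hs.nonempty
    exact h ⟨c.root, ⟨n + 1, c, hchild n r hr c hc, rfl⟩, hs.pInit hc⟩
  have hfin : ∀ v ∈ S, (suc S v).Finite := by
    rintro _ ⟨n, r, hr, rfl⟩
    rw [hsuc n r hr]
    exact (Finset.finite_toSet _).image _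
  -- The successors of a root in `S` are the roots of its splitting family, and these take `growth m
  -- ^ n` values at the splitting place.
  have hnor : ∀ n, ∀ r ∈ G n, n ≤ logNorm (suc S r.root) := by
    intro n r hr
    have hs := hsplit n r (hGI n r hr)
    refine le_logNorm (hfin _ ⟨n, r, hr, rfl⟩) (m := pl n r) (hs.le_card.trans ?_)
    rw [← ncard_coe_finset]
    refine ncard_le_ncard_of_injOn (fun c : LogForcing e => c.root[pl n r]?.getD 0) ?_ ?_
      (vals_finite (hfin _ ⟨n, r, hr, rfl⟩) _)
    · intro c hc
      refine ⟨c.root, hsuc n r hr ▸ mem_image_of_mem _ hc, ?_⟩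
      simp [List.getElem?_eq_getElem (hs.lt_length c hc)]
    · intro c hc d hd hcd
      refine hs.injOn c hc d hd ?_
      simpa [List.getElem?_eq_getElem (hs.lt_length c hc),
        List.getElem?_eq_getElem (hs.lt_length d hd)] using hcd
  obtain ⟨q, hq, hq4⟩ : ∃ q : LogForcing e, q.T = S ∧ NormCondition q.T q.t 4 := by
    refine TreeForcing.exists_of_tree (fun v hv => p.subset (hSp hv))
      ⟨p.root, ⟨0, p, by simp [hG0], rfl⟩, fun v hv => p.isRoot.2 v (hSp hv)⟩ hmax hfin fun n => ?_
    -- Only the finitely many roots from levels below `n` can have norm below `n`, so longer points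
    -- have large norm.
    obtain ⟨b, hb⟩ := (((Finset.range n).biUnion G).finite_toSet.image
      fun r : LogForcing e => r.root.length).bddAbove
    refine ⟨b + 1, ?_⟩
    rintro _ ⟨k, r, hr, rfl⟩ hl
    by_contra! h
    have hkn : k < n := (hnor k r hr).trans_lt h
    have := hb ⟨r, by simpa using ⟨k, hkn, hr⟩, rfl⟩
    exact absurd (Nat.lt_of_succ_le hl) (not_lt.2 this)
  refine ⟨q, TreeForcing.le_iff.2 (hq ▸ hSp), hq4, G, hGI, fun n q' hqq' => ?_⟩
  have hq'S : q'.T ⊆ S := hq ▸ TreeForcing.le_iff.1 hqq'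
  -- Moving to proper extensions in `q'.T` increases the level.
  have hdeep : ∀ n, ∃ k, n ≤ k ∧ ∃ d ∈ G k, d.root ∈ q'.T := by
    intro n
    induction n with
    | zero =>
      obtain ⟨k, d, hd, hdq⟩ := hq'S q'.root_mem
      exact ⟨k, Nat.zero_le k, d, hd, hdq ▸ q'.root_mem⟩
    | succ n ih =>
      obtain ⟨k, hk, d, hd, hdq⟩ := ih
      obtain ⟨u, hu, hdu⟩ := q'.exists_pInit hdq
      obtain ⟨l, d', hd', rfl⟩ := hq'S hu
      exact ⟨l, Nat.succ_le_of_lt (hk.trans_lt (hdepth k l d hd d' hd' hdu)), d', hd', hu⟩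
  obtain ⟨k, hk, d, hd, hdq⟩ := hdeep n
  obtain ⟨r, hr, hrd⟩ := hanc n k hk d hd
  -- The common extension is the cone of `q'` at a root descending from `r`: all points of `S` above
  -- the root of `r` lie in `r.T`.
  refine ⟨r, hr, q'.cone hdq, TreeForcing.le_iff.2 ?_, q'.le_cone hdq⟩
  rw [q'.cone_T hdq]
  rintro u ⟨hu, hdu⟩
  obtain ⟨l, d', hd', rfl⟩ := hq'S hu
  exact hmemT n r hr l d' hd' ((TreeForcing.root_prefix hrd).trans hdu)

end LogForcing

/-! ### Forcing equivalence -/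

section Equivalence

variable {e e' : Fin 5}

/-- A condition that satisfies another norm condition as well. -/
def TreeForcing.withNorm (p : LogForcing e) (h : NormCondition p.T p.t e') : LogForcing e' :=
  ⟨p.T, p.t, p.subset, p.quasiTree, p.no_max, p.mem, p.treeCreature, p.rng_eq, h⟩

/-- A fusion without side conditions thins any tree to one that satisfies norm condition `4`, and
hence all five. -/
theorem TreeForcing.exists_subset (p : LogForcing e) (e' : Fin 5) :
    ∃ q : LogForcing e', q.T ⊆ p.T := by
  obtain ⟨q, hpq, hq, -⟩ := fusion (fun _ _ => True) (p := p) trivial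
    fun n r _ => (exists_isSplit r n).imp fun m h => h.imp fun F h => ⟨h, fun _ _ => trivial⟩
  exact ⟨q.withNorm (normCondition_of_four q.no_max hq e'), le_iff.1 hpq⟩

/-- Every condition satisfies the norm condition number `2`. -/
noncomputable def toAntisymmetrization_two (p : LogForcing e) :
    Antisymmetrization (LogForcing 2) (· ≤ ·) :=
  _root_.toAntisymmetrization (· ≤ ·) (p.withNorm (normCondition_two p.no_max p.norm))

/-- A tree with norm condition `2` contains a tree with norm condition `e`, which gives density and
reflects compatibility. The quotient is needed because conditions with the same tree are equivalent
but may not be equal. -/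
theorem isDenseEmbedding_toAntisymmetrization_two :
    IsDenseEmbedding (toAntisymmetrization_two (e := e)) := by
  refine ⟨fun p q h => ?_, fun p q h h' => h ?_, fun r => ?_⟩
  · exact toAntisymmetrization_le_toAntisymmetrization_iff.2
      (TreeForcing.le_iff.2 (TreeForcing.le_iff.1 h))
  · obtain ⟨r, hpr, hqr⟩ := h'
    induction r using Antisymmetrization.ind with
    | _ r =>
    have hpr := TreeForcing.le_iff.1 (toAntisymmetrization_le_toAntisymmetrization_iff.1 hpr)
    have hqr := TreeForcing.le_iff.1 (toAntisymmetrization_le_toAntisymmetrization_iff.1 hqr)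
    obtain ⟨s, hs⟩ := r.exists_subset e
    exact ⟨s, TreeForcing.le_iff.2 (hs.trans hpr), TreeForcing.le_iff.2 (hs.trans hqr)⟩
  · induction r using Antisymmetrization.ind with
    | _ r =>
    obtain ⟨s, hs⟩ := r.exists_subset e
    exact ⟨s, toAntisymmetrization_le_toAntisymmetrization_iff.2 (TreeForcing.le_iff.2 hs)⟩

theorem forcingEquivalent_log (e e' : Fin 5) :
    ForcingEquivalent (LogForcing e) (LogForcing e') :=
  ⟨_, inferInstance, _, _, isDenseEmbedding_toAntisymmetrization_two,
    isDenseEmbedding_toAntisymmetrization_two⟩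

end Equivalence

/-! ### Properness and bounding -/

theorem fMem_mono {P I : Type} [Preorder P] {i : I} {X : Name P I} {p q : P} (hpq : p ≤ q)
    (h : fMem i X p) : fMem i X q := fun r hr => h r (hpq.trans hr)

/-- Countable sets have countable closures under binary operations with countable values. -/
theorem exists_countable_closed {X : Type} (g : X → X → Set X) (hg : ∀ x y, (g x y).Countable)
    {a : Set X} (ha : a.Countable) :
    ∃ N : Set X, N.Countable ∧ a ⊆ N ∧ ∀ x ∈ N, ∀ y ∈ N, g x y ⊆ N := by
  let step : Set X → Set X := fun N => N ∪ ⋃ x ∈ N, ⋃ y ∈ N, g x y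
  have hc : ∀ n, (step^[n] a).Countable := fun n => by
    induction n with
    | zero => exact ha
    | succ n ih =>
      rw [Function.iterate_succ_apply']
      exact ih.union (ih.biUnion fun x _ => ih.biUnion fun y _ => hg x y)
  have hm : Monotone fun n => step^[n] a := monotone_nat_of_le_succ fun n => by
    rw [Function.iterate_succ_apply']
    exact subset_union_left
  refine ⟨⋃ n, step^[n] a, countable_iUnion hc, subset_iUnion (fun n => step^[n] a) 0, ?_⟩
  intro x hx y hy z hz
  obtain ⟨i, hi⟩ := mem_iUnion.1 hx
  obtain ⟨j, hj⟩ := mem_iUnion.1 hy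
  refine mem_iUnion.2 ⟨max i j + 1, ?_⟩
  rw [Function.iterate_succ_apply']
  exact .inr (mem_biUnion (hm (le_max_left i j) hi) (mem_biUnion (hm (le_max_right i j) hj) hz))

section Proper

variable {e : Fin 5}

/-- Fusion inside `N`: level `n + 1` lies in the `n`th dense set of `N`, and every extension of the
fusion is compatible with a member of that level. -/
theorem isProper_log : IsProper (LogForcing e) := by
  have hex : ∀ (r : LogForcing e) (n : ℕ) (D : Set (LogForcing e)), IsDense D →
      ∃ m F, IsSplit n m r F ∧ ∀ c ∈ F, c ∈ D := fun r n D hD =>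
    exists_isSplit_of_dense r n fun c _ => (hD c).imp fun d hd => ⟨hd.2, hd.1⟩
  choose! pl ch hsplit hch using hex
  -- The club consists of the countable sets closed under the fixed choice of splitting families, so
  -- that the fusion never leaves `N`.
  let g : LogForcing e ⊕ Set (LogForcing e) → LogForcing e ⊕ Set (LogForcing e) →
      Set (LogForcing e ⊕ Set (LogForcing e)) := fun x y =>
    {z | ∃ r n D, x = .inl r ∧ y = .inr D ∧ ∃ c ∈ ch r n D, z = .inl c}
  have hg : ∀ x y, (g x y).Countable := by
    intro x y
    rcases x with r | D'
    · rcases y with r' | D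
      · exact countable_empty.mono (by rintro z ⟨r, n, D, -, h, -⟩; cases h)
      · refine (countable_iUnion fun n : ℕ =>
          ((ch r n D).countable_toSet.image Sum.inl)).mono ?_
        rintro z ⟨r, n, D, h, h', c, hc, rfl⟩
        cases h
        cases h'
        exact mem_iUnion.2 ⟨n, c, hc, rfl⟩
    · exact countable_empty.mono (by rintro z ⟨r, n, D, h, -⟩; cases h)
  refine ⟨{N | N.Countable ∧ ∀ x ∈ N, ∀ y ∈ N, g x y ⊆ N}, ⟨fun N hN => hN.1, fun a ha => ?_,
    fun c hc hcC => ⟨countable_iUnion fun n => (hcC n).1, fun x hx y hy => ?_⟩⟩, ?_⟩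
  · obtain ⟨N, hN, haN, hcl⟩ := exists_countable_closed g hg ha
    exact ⟨N, ⟨hN, hcl⟩, haN⟩
  · obtain ⟨i, hi⟩ := mem_iUnion.1 hx
    obtain ⟨j, hj⟩ := mem_iUnion.1 hy
    exact ((hcC (max i j)).2 x (hc (le_max_left i j) hi) y (hc (le_max_right i j) hj)).trans
      (subset_iUnion c _)
  · rintro N ⟨hN, hcl⟩ p hp
    rcases {D : Set (LogForcing e) | IsDense D ∧ Sum.inr D ∈ N}.eq_empty_or_nonempty with h0 | hne
    · exact ⟨p, le_rfl, fun D hD hDN => absurd (show D ∈ {D | IsDense D ∧ Sum.inr D ∈ N} from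
        ⟨hD, hDN⟩) (h0 ▸ notMem_empty D)⟩
    have hcount : {D : Set (LogForcing e) | IsDense D ∧ Sum.inr D ∈ N}.Countable :=
      (hN.preimage Sum.inr_injective).mono fun D hD => hD.2
    obtain ⟨f, hf⟩ := hcount.exists_eq_range hne
    have hfD : ∀ n, IsDense (f n) ∧ Sum.inr (f n) ∈ N := fun n =>
      (hf ▸ mem_range_self n : f n ∈ {D : Set (LogForcing e) | IsDense D ∧ Sum.inr D ∈ N})
    obtain ⟨q, hpq, -, G, hG, hpre⟩ := fusion
      (fun n r => Sum.inl r ∈ N ∧ ∀ k, n = k + 1 → r ∈ f k) (p := p) ⟨hp, by simp⟩ (by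
        rintro n r ⟨hr, -⟩
        refine ⟨_, _, hsplit r n (f n) (hfD n).1, fun c hc => ⟨?_, ?_⟩⟩
        · exact hcl _ hr _ (hfD n).2 ⟨r, n, f n, rfl, rfl, c, hc, rfl⟩
        · rintro k hk
          obtain rfl : n = k := by omega
          exact hch r n (f n) (hfD n).1 c hc)
    refine ⟨q, hpq, fun D hD hDN r hr => ?_⟩
    obtain ⟨n, rfl⟩ : D ∈ range f := hf ▸ ⟨hD, hDN⟩
    obtain ⟨d, hd, hcomp⟩ := hpre (n + 1) r hr
    exact ⟨d, (hG _ d hd).2 n rfl, (hG _ d hd).1, hcomp⟩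

/-- Level `n + 1` of the fusion decides the value at `n`; the level is finite, so the supremum of
the decided values plus one is a strict bound. -/
theorem baireBounding_log : BaireBounding (LogForcing e) := by
  classical
  intro x _ p _ hx q hpq
  have hdec : ∀ n r, p ≤ r → ∃ s, r ≤ s ∧ ∃ m, fMem (n, m) x s := fun n r hr => hx.1 n r hr
  obtain ⟨q', hqq', -, G, hG, hpre⟩ := fusion
    (fun n r => p ≤ r ∧ ∀ k, n = k + 1 → ∃ m, fMem (k, m) x r) (p := q) ⟨hpq, by simp⟩ (by
      rintro n r ⟨hr, -⟩
      obtain ⟨m, F, hF, hFm⟩ := exists_isSplit_of_dense r n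
        (D := fun d => ∃ m, fMem (n, m) x d) fun c hc => hdec n c (hr.trans hc)
      refine ⟨m, F, hF, fun c hc => ⟨hr.trans (hF.le c hc), fun k hk => ?_⟩⟩
      obtain rfl : n = k := by omega
      exact hFm c hc)
  choose! v hv using fun n r (hr : r ∈ G (n + 1)) => (hG (n + 1) r hr).2 n rfl
  refine ⟨q', hqq', fun n => (G (n + 1)).sup (fun r => v n r + 1), fun r hr => ⟨r, le_rfl, 0, ?_⟩⟩
  intro n s hs _ m s' hs' hm
  obtain ⟨c, hc, u, hcu, hsu⟩ := hpre (n + 1) s' ((hr.trans hs).trans hs')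
  have hpu : p ≤ u := (hG (n + 1) c hc).1.trans hcu
  have hmv : m = v n c := hx.2 n m (v n c) u hpu ⟨fMem_mono hsu hm, fMem_mono hcu (hv n c hc)⟩
  have := Finset.le_sup (f := fun r => v n r + 1) hc
  exact hmv ▸ this

end Proper

/-! ### The failure of the Sacks property -/

section Sacks

variable {e : Fin 5}

/-- The full tree is a condition: at length `m` the alphabet has `growth m ^ (m + 1)` letters, so
the norm there is at least `m`. -/
instance : Nonempty (LogForcing e) := by
  have hnil : ([] : List ℕ) ∈ FinSeq alphabet := fun i hi => absurd hi (by simp)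
  have happ : ∀ v ∈ FinSeq alphabet, ∀ x ∈ alphabet v.length, v ++ [x] ∈ FinSeq alphabet := by
    intro v hv x hx i hi
    rcases lt_or_ge i v.length with h | h
    · rw [List.getElem_append_left h]
      exact hv i h
    · obtain rfl : i = v.length := by
        simp only [List.length_append, List.length_singleton] at hi
        omega
      simpa using hx
  have hpre : ∀ v : List ℕ, ∀ x, PInit v (v ++ [x]) := fun v x =>
    .of_length_lt (List.prefix_append _ _) (by simp)
  have hsuc : ∀ v ∈ FinSeq alphabet,
      suc (FinSeq alphabet) v = (fun x => v ++ [x]) '' alphabet v.length := by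
    intro v hv
    ext u
    constructor
    · rintro ⟨hu, hvu, hmin⟩
      obtain ⟨w, rfl⟩ := hvu.1
      rcases w with - | ⟨x, w⟩
      · simp [PInit] at hvu
      have hx : x ∈ alphabet v.length := by
        have := hu v.length (by simp)
        simpa using this
      have hvx : v ++ [x] <+: v ++ x :: w := ⟨w, by simp⟩
      refine ⟨x, hx, (eq_or_pInit hvx).resolve_right fun h => hmin ?_⟩
      exact ⟨_, happ v hv x hx, hpre v x, h⟩
    · rintro ⟨x, hx, rfl⟩
      refine ⟨happ v hv x hx, hpre v x, fun ⟨w, _, hvw, hwx⟩ => ?_⟩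
      have h1 := hvw.length_lt
      have h2 := hwx.length_lt
      simp only [List.length_append, List.length_singleton] at h2
      omega
  have hfin : ∀ v ∈ FinSeq alphabet, (suc (FinSeq alphabet) v).Finite := fun v hv =>
    hsuc v hv ▸ (finite_Iio _).image _
  have hnor : ∀ v ∈ FinSeq alphabet, v.length ≤ logNorm (suc (FinSeq alphabet) v) := by
    intro v hv
    refine (Nat.le_succ _).trans (le_logNorm (hfin v hv) (m := v.length) ?_)
    have : alphabet v.length ⊆ vals v.length (suc (FinSeq alphabet) v) := fun x hx =>
      ⟨v ++ [x], hsuc v hv ▸ ⟨x, hx, rfl⟩, by simp⟩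
    refine le_trans ?_ (ncard_le_ncard this (vals_finite (hfin v hv) _))
    rw [alphabet, ← Finset.coe_Iio, ncard_coe_finset, Nat.card_Iio]
  have hmax : maxPts (FinSeq alphabet) = ∅ := eq_empty_of_forall_notMem fun v hv => by
    obtain ⟨x, hx⟩ := (alphabet_nontrivial v.length).nonempty
    exact hv.2 ⟨_, happ v hv.1 x hx, hpre v x⟩
  obtain ⟨p, -⟩ := TreeForcing.exists_of_tree (e := e) Subset.rfl
    ⟨[], hnil, fun _ _ => List.nil_prefix⟩ hmax hfin
    fun n => ⟨n, fun v hv hn => hn.trans (hnor v hv)⟩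
  exact ⟨p⟩

theorem TreeForcing.exists_lt_length_root (p : LogForcing e) (n : ℕ) :
    ∃ q, p ≤ q ∧ n < q.root.length := by
  obtain ⟨x, hx, -⟩ := exists_branch p.no_max p.root_mem
  obtain ⟨k, hk, hkT⟩ := hx n
  exact ⟨p.cone hkT, p.le_cone hkT, by rwa [p.root_cone, length_restr]⟩

/-- The canonical name for the generic real: the union of the roots of the conditions in the
generic filter. -/
def genericReal : Name (LogForcing e) (ℕ × ℕ) := fun z => {p | p.root[z.1]? = some z.2}

theorem getElem?_root_of_le {p q : LogForcing e} (h : p ≤ q) {n m : ℕ}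
    (hp : p.root[n]? = some m) : q.root[n]? = some m := by
  obtain ⟨w, hw⟩ := TreeForcing.root_prefix h
  obtain ⟨hn, -⟩ := List.getElem?_eq_some_iff.1 hp
  rw [← hw, List.getElem?_append_left hn, hp]

theorem fMem_genericReal {p : LogForcing e} {n m : ℕ} (hp : p.root[n]? = some m) :
    fMem (n, m) genericReal p := fun q hq => ⟨q, le_rfl, p, hp, hq⟩

theorem fIsFun_genericReal (p : LogForcing e) : fIsFun genericReal p := by
  refine ⟨fun n q _ => ?_, fun n m m' q _ ⟨h, h'⟩ => ?_⟩
  · obtain ⟨r, hqr, hr⟩ := q.exists_lt_length_root n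
    exact ⟨r, hqr, r.root[n], fMem_genericReal (List.getElem?_eq_getElem hr)⟩
  · obtain ⟨r, hr, s, hs, hsr⟩ := h q le_rfl
    obtain ⟨r', hr', s', hs', hsr'⟩ := h' r hr
    have h1 := getElem?_root_of_le (hsr.trans hr') hs
    have h2 := getElem?_root_of_le hsr' hs'
    exact Option.some_injective _ (h1.symm.trans h2)

/-- Were the generic real captured by `F`, a splitting family with exponent `2` below the deciding
condition would put `growth m ^ 2 > m + 1` values into `F m`. -/
theorem not_sacksProperty_log : ¬ SacksProperty (LogForcing e) := by
  intro h
  obtain ⟨p⟩ : Nonempty (LogForcing e) := inferInstance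
  obtain ⟨q, -, F, hF⟩ := h genericReal p p le_rfl (fIsFun_genericReal p) p le_rfl
  obtain ⟨m, S, hS⟩ := exists_isSplit q 2
  have hmem : ∀ c ∈ S, c.root[m]?.getD 0 ∈ F.1 m := by
    intro c hc
    have h1 := List.getElem?_eq_getElem (hS.lt_length c hc)
    have := hF m _ c (hS.le c hc) (fMem_genericReal h1)
    rwa [h1]
  have hcard := Finset.card_le_card_of_injOn _ hmem fun c hc d hd hcd => by
    refine hS.injOn c hc d hd ?_
    simpa [List.getElem?_eq_getElem (hS.lt_length c hc),
      List.getElem?_eq_getElem (hS.lt_length d hd)] using hcd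
  have h1 := hS.le_card.trans hcard
  rw [F.2 m, pow_two] at h1
  have h2 := lt_growth m
  nlinarith [one_lt_growth m]

end Sacks

/-! ### Preservation of non-meager sets -/

section Meager

variable {e : Fin 5}

theorem restr_eq_restr {A : Type} {x y : ℕ → A} {n : ℕ} :
    restr x n = restr y n ↔ ∀ i < n, x i = y i := by
  simp [restr]

theorem isOpen_restr_eq (s : List Bool) : IsOpen {x : ℕ → Bool | restr x s.length = s} := by
  have : {x : ℕ → Bool | restr x s.length = s} =
      ⋂ i : Fin s.length, (fun x : ℕ → Bool => x i) ⁻¹' {s[i]} := by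
    ext x
    simp only [mem_ofPred_eq, mem_iInter, mem_preimage, mem_singleton_iff]
    refine ⟨fun h i => ?_, fun h => List.ext_getElem (by simp) fun i h1 h2 => ?_⟩
    · have := getElem_restr x s.length i (by simp)
      simp only [h] at this
      exact this.symm
    · rw [getElem_restr]
      exact h ⟨i, h2⟩
  rw [this]
  exact isOpen_iInter_of_finite fun i => (isOpen_discrete _).preimage (continuous_apply _)

theorem exists_restr_of_isOpen {U : Set (ℕ → Bool)} (hU : IsOpen U) {x : ℕ → Bool} (hx : x ∈ U) :
    ∃ n, ∀ y, restr y n = restr x n → y ∈ U := by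
  obtain ⟨_, ⟨z, n, rfl⟩, hxz, hsub⟩ :=
    (PiNat.isTopologicalBasis_cylinders (fun _ : ℕ => Bool)).exists_subset_of_mem_open hx hU
  refine ⟨n, fun y hy => hsub ?_⟩
  rw [restr_eq_restr] at hy
  exact fun i hi => (hy i hi).trans (hxz i hi)

theorem exists_restr_eq (s : List Bool) : ∃ x : ℕ → Bool, restr x s.length = s :=
  ⟨fun i => s[i]?.getD false, List.ext_getElem (by simp) fun i h1 h2 => by
    rw [getElem_restr]
    simp [List.getElem?_eq_getElem h2]⟩

theorem dense_of_forall_restr {O : Set (ℕ → Bool)}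
    (h : ∀ s : List Bool, ∃ t, s <+: t ∧ ∀ x, restr x t.length = t → x ∈ O) : Dense O := by
  refine dense_iff_inter_open.2 fun U hU ⟨x, hx⟩ => ?_
  obtain ⟨n, hn⟩ := exists_restr_of_isOpen hU hx
  obtain ⟨t, hst, ht⟩ := h (restr x n)
  obtain ⟨y, hy⟩ := exists_restr_eq t
  refine ⟨y, hn y ?_, ht y hy⟩
  rw [← hy] at hst
  have := eq_restr_of_prefix hst
  rw [length_restr] at this
  exact this.symm

/-- Sets `S n` witnessing meagerness are defeated by a single `x ∈ A` in countably many ground model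
dense open sets: the fusion guided by `x` ensures at level `n + 1` that `x` is outside the `n`th
closed set. -/
theorem preservesNonMeager_log : PreservesNonMeager (LogForcing e) := by
  classical
  intro A hA _ p₁ _ hp₁
  obtain ⟨p, -, S, hnwd, hcov⟩ := hp₁ p₁ le_rfl
  -- a splitting family all of whose members exclude initial segments of one sequence
  have hsplit : ∀ (r : LogForcing e) (n : ℕ) (s : List Bool), p ≤ r →
      ∃ (m : ℕ) (F : Finset (LogForcing e)) (t : List Bool), IsSplit n m r F ∧ s <+: t ∧
        ∀ c ∈ F, ∃ u, u <+: t ∧ fNot (fMem (n, u) S) c := by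
    intro r n s hr
    obtain ⟨m, F, hF⟩ := exists_isSplit r n
    -- The members are treated one after another; each strengthens its condition and lengthens the
    -- common sequence `t`, and earlier exclusions concern initial segments of the longer sequence.
    have key : ∀ F' : Finset (LogForcing e), (∀ c ∈ F', p ≤ c) →
        ∃ (f : LogForcing e → LogForcing e) (t : List Bool), s <+: t ∧
          ∀ c ∈ F', c ≤ f c ∧ ∃ u, u <+: t ∧ fNot (fMem (n, u) S) (f c) := by
      intro F'
      induction F' using Finset.induction_on with
      | empty => exact fun _ => ⟨id, s, List.prefix_rfl, by simp⟩
      | insert c F' hc ih =>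
        intro hp
        obtain ⟨f, t, hst, hf⟩ := ih fun d hd => hp d (Finset.mem_insert_of_mem hd)
        obtain ⟨d, hcd, u, htu, hu⟩ := hnwd n t c (hp c (Finset.mem_insert_self c F'))
        refine ⟨Function.update f c d, u, hst.trans htu, fun c' hc' => ?_⟩
        rcases Finset.mem_insert.1 hc' with rfl | hc''
        · rw [Function.update_self]
          exact ⟨hcd, u, List.prefix_rfl, hu⟩
        · have hne : c' ≠ c := fun h => hc (h ▸ hc'')
          rw [Function.update_of_ne hne]
          obtain ⟨h1, w, hw, h2⟩ := hf c' hc''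
          exact ⟨h1, w, hw.trans htu, h2⟩
    obtain ⟨f, t, hst, hf⟩ := key F fun c hc => hr.trans (hF.le c hc)
    refine ⟨m, F.image f, t, hF.image f fun c hc => (hf c hc).1, hst, fun d hd => ?_⟩
    obtain ⟨c, hc, rfl⟩ := Finset.mem_image.1 hd
    exact (hf c hc).2
  choose! pl ch ext hsplit hext hch using hsplit
  -- Which families the fusion will use depends on `x`, which is not yet chosen. All conditions that
  -- may occur lie in the countable set `N`.
  obtain ⟨N, hN, hpN, hcl⟩ := exists_countable_closed
    (fun r _ : LogForcing e => ⋃ (n : ℕ) (s : List Bool), (ch r n s : Set (LogForcing e)))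
    (fun r _ => countable_iUnion fun n => countable_iUnion fun s => (ch r n s).countable_toSet)
    (countable_singleton p)
  let O : LogForcing e → ℕ → Set (ℕ → Bool) := fun r n =>
    ⋃ s : List Bool, {x | restr x (ext r n s).length = ext r n s}
  have hO : ∀ r, p ≤ r → ∀ n, O r n ∈ residual (ℕ → Bool) := fun r hr n =>
    residual_of_dense_open (isOpen_iUnion fun s => isOpen_restr_eq _)
      (dense_of_forall_restr fun s => ⟨ext r n s, hext r n s hr, fun x hx => mem_iUnion.2 ⟨s, hx⟩⟩)
  have hres : (⋂ r ∈ {r ∈ N | p ≤ r}, ⋂ n, O r n) ∈ residual (ℕ → Bool) :=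
    (countable_bInter_mem (hN.mono fun r hr => hr.1)).2 fun r hr =>
      countable_iInter_mem.2 fun n => hO r hr.2 n
  obtain ⟨x, hxA, hx⟩ : ∃ x ∈ A, x ∈ ⋂ r ∈ {r ∈ N | p ≤ r}, ⋂ n, O r n := by
    by_contra! h
    exact hA (mem_of_superset hres fun x hx hxA => h x hxA hx)
  obtain ⟨q, hpq, -, G, hG, hpre⟩ := fusion
    (fun n r => r ∈ {r ∈ N | p ≤ r} ∧ ∀ k, n = k + 1 → ∃ l, fNot (fMem (k, restr x l) S) r)
    (p := p) ⟨⟨hpN rfl, le_rfl⟩, by simp⟩ (by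
      rintro n r ⟨hr, -⟩
      obtain ⟨s, hs⟩ := mem_iUnion.1 (mem_iInter.1 (mem_iInter₂.1 hx r hr) n)
      have hsp := hsplit r n s hr.2
      refine ⟨_, _, hsp, fun c hc => ⟨⟨?_, hr.2.trans (hsp.le c hc)⟩, ?_⟩⟩
      · exact hcl r hr.1 r hr.1 (mem_iUnion₂.2 ⟨n, s, hc⟩)
      · intro k hk
        obtain rfl : n = k := by omega
        obtain ⟨u, hu, hcu⟩ := hch r n s hr.2 c hc
        have hs' : restr x (ext r n s).length = ext r n s := hs
        rw [← hs'] at hu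
        rw [eq_restr_of_prefix hu] at hcu
        exact ⟨_, hcu⟩)
  obtain ⟨q', hqq', n, hn⟩ := hcov ⟨x, hxA⟩ q hpq
  obtain ⟨r, hr, u, hru, hqu⟩ := hpre (n + 1) q' hqq'
  obtain ⟨l, hl⟩ := (hG (n + 1) r hr).2 n rfl
  exact hl u hru (fMem_mono hqu (hn l))

end Meager

/-! ### Preservation of outer measure -/

section Measure

instance : IsProbabilityMeasure cantorMeasure := by
  unfold cantorMeasure
  infer_instance

/-- The basic clopen set determined by a finite sequence. -/
def cyl (s : List Bool) : Set (ℕ → Bool) := {x | restr x s.length = s}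

theorem cantorMeasure_cyl (s : List Bool) :
    cantorMeasure (cyl s) = ((1 / 2 : ℝ≥0) ^ s.length : ℝ≥0) := by
  have : cyl s = Set.pi (Finset.range s.length) fun i => {s[i]?.getD false} := by
    ext x
    simp only [cyl, mem_ofPred_eq, Set.mem_pi, Finset.mem_coe, Finset.mem_range, mem_singleton_iff]
    refine ⟨fun h i hi => ?_, fun h => List.ext_getElem (by simp) fun i h1 h2 => ?_⟩
    · have := getElem_restr x s.length i (by simpa using hi)
      simp only [h] at this
      simp [List.getElem?_eq_getElem hi, this]
    · rw [getElem_restr, h i h2]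
      simp [List.getElem?_eq_getElem h2]
  rw [this, cantorMeasure, Measure.infinitePi_pi _ fun i _ => measurableSet_singleton _]
  have h2 : ∀ b : Bool, (PMF.uniformOfFintype Bool).toMeasure {b} = ((1 / 2 : ℝ≥0) : ℝ≥0∞) := by
    intro b
    rw [PMF.toMeasure_apply_singleton _ _ (measurableSet_singleton b)]
    simp
  simp only [h2, Finset.prod_const, Finset.card_range]
  push_cast
  rfl

theorem isOpen_cyl (s : List Bool) : IsOpen (cyl s) := isOpen_restr_eq s

theorem measurableSet_cyl (s : List Bool) : MeasurableSet (cyl s) := (isOpen_cyl s).measurableSet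

theorem mem_cyl_restr (x : ℕ → Bool) (n : ℕ) : x ∈ cyl (restr x n) := by simp [cyl]

/-- A ground model cover keeps working in the extension. Its name is the check name of `W`. -/
theorem forced_fOuterLE {P : Type} [Preorder P] {A : Set (ℕ → Bool)} {r : ℝ≥0}
    (h : cantorMeasure A < r) : Forced (P := P) (fOuterLE A r) := by
  classical
  obtain ⟨U, hAU, hU, hUr⟩ := A.exists_isOpen_lt_of_lt _ h
  -- Minimal sequences whose cylinders lie in `U` have disjoint cylinders, so their measures add up
  -- to at most the measure of `U`.
  set W : Set (List Bool) := {s | cyl s ⊆ U ∧ ∀ t, PInit t s → ¬ cyl t ⊆ U} with hW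
  intro p q _
  refine ⟨q, le_rfl, fun s => {_p | s ∈ W}, fun x r _ => ⟨r, le_rfl, ?_⟩, fun F q' _ hF => ?_⟩
  · have hex : ∃ n, cyl (restr x.1 n) ⊆ U := by
      obtain ⟨n, hn⟩ := exists_restr_of_isOpen hU (hAU x.2)
      exact ⟨n, fun y hy => hn y (by simpa [cyl] using hy)⟩
    refine ⟨Nat.find hex, fun q' _ => ⟨q', le_rfl, q', ⟨Nat.find_spec hex, fun t ht htU => ?_⟩,
      le_rfl⟩⟩
    rw [eq_restr_of_prefix ht.1] at htU
    have := ht.length_lt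
    rw [length_restr] at this
    exact Nat.find_min hex this htU
  · have hFW : ∀ s ∈ F, s ∈ W := fun s hs => by
      obtain ⟨_, _, _, hsW, _⟩ := hF ⟨s, hs⟩ q' le_rfl
      exact hsW
    have hdisj : (F : Set (List Bool)).PairwiseDisjoint cyl := by
      intro s hs t ht hst
      refine disjoint_left.2 fun x (hxs : restr x s.length = s) (hxt : restr x t.length = t) => ?_
      rcases lt_trichotomy s.length t.length with hl | hl | hl
      · exact (hFW t ht).2 s (hxs ▸ hxt ▸ restr_pInit x hl) (hFW s hs).1
      · exact hst (by rw [← hxs, ← hxt, hl])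
      · exact (hFW s hs).2 t (hxs ▸ hxt ▸ restr_pInit x hl) (hFW t ht).1
    have hle : (∑ s ∈ F, ((1 / 2 : ℝ≥0) ^ s.length : ℝ≥0) : ℝ≥0∞) ≤ r := by
      calc (∑ s ∈ F, ((1 / 2 : ℝ≥0) ^ s.length : ℝ≥0) : ℝ≥0∞)
          = ∑ s ∈ F, cantorMeasure (cyl s) := by simp only [cantorMeasure_cyl]
        _ = cantorMeasure (⋃ s ∈ F, cyl s) :=
          (measure_biUnion_finset hdisj fun s _ => measurableSet_cyl s).symm
        _ ≤ cantorMeasure U := measure_mono (iUnion₂_subset fun s hs => (hFW s hs).1)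
        _ ≤ r := hUr.le
    exact_mod_cast hle

open Classical in
/-- If the sets `E c` have measure at most `b` then the set of points that are outside of less
than the `M`th part of them has measure at most `M * b / (M - 1)`. -/
theorem measureReal_few_le {X ι : Type} [MeasurableSpace X] (μ : Measure X) [IsFiniteMeasure μ]
    (F : Finset ι) (hF : F.Nonempty) (E : ι → Set X) (hE : ∀ c ∈ F, MeasurableSet (E c)) (M : ℕ)
    (b : ℝ) (hb : ∀ c ∈ F, μ.real (E c) ≤ b) :
    MeasurableSet {x | M * {c ∈ F | x ∉ E c}.card < F.card} ∧
      ((M : ℝ) - 1) * μ.real {x | M * {c ∈ F | x ∉ E c}.card < F.card} ≤ M * b := by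
  set B : Set X := {x | M * {c ∈ F | x ∉ E c}.card < F.card} with hB
  have hBm : MeasurableSet B := by
    refine measurableSet_lt (measurable_const.mul ?_) measurable_const
    simp only [Finset.card_filter]
    exact Finset.measurable_sum _ fun c hc =>
      Measurable.ite (hE c hc).compl measurable_const measurable_const
  refine ⟨hBm, ?_⟩
  -- For `x ∈ B` more than the fraction `1 - 1 / M` of the sets `E c` contain `x`; integrating this
  -- gives the bound.
  have hpt : ∀ x, B.indicator (fun _ => ((M : ℝ) - 1) * F.card) x ≤
      M * ∑ c ∈ F, (E c).indicator (fun _ => (1 : ℝ)) x := by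
    intro x
    have hsum : ∑ c ∈ F, (E c).indicator (fun _ => (1 : ℝ)) x = ({c ∈ F | x ∈ E c}.card : ℝ) := by
      simp [Set.indicator_apply]
    rw [hsum]
    by_cases hx : x ∈ B
    · rw [Set.indicator_of_mem hx]
      have h1 : (M : ℝ) * {c ∈ F | x ∉ E c}.card < F.card := by exact_mod_cast hx
      have h2 : ({c ∈ F | x ∈ E c}.card : ℝ) + {c ∈ F | x ∉ E c}.card = F.card := by
        exact_mod_cast Finset.card_filter_add_card_filter_not (s := F) (fun c => x ∈ E c)
      have h3 : (M : ℝ) * {c ∈ F | x ∈ E c}.card + M * {c ∈ F | x ∉ E c}.card = M * F.card := by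
        rw [← mul_add, h2]
      linarith
    · rw [Set.indicator_of_notMem hx]
      positivity
  have hint : ∀ c ∈ F, Integrable ((E c).indicator fun _ => (1 : ℝ)) μ := fun c hc =>
    (integrable_const 1).indicator (hE c hc)
  have h := integral_mono ((integrable_const (((M : ℝ) - 1) * F.card)).indicator hBm)
    ((integrable_finsetSum F hint).const_mul (M : ℝ)) hpt
  rw [integral_indicator_const _ hBm, integral_const_mul, integral_finsetSum F hint] at h
  have h' : ∑ c ∈ F, ∫ x, (E c).indicator (fun _ => (1 : ℝ)) x ∂μ ≤ F.card * b := by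
    calc ∑ c ∈ F, ∫ x, (E c).indicator (fun _ => (1 : ℝ)) x ∂μ
        = ∑ c ∈ F, μ.real (E c) := Finset.sum_congr rfl fun c hc => by
          rw [integral_indicator_const _ (hE c hc)]
          simp
      _ ≤ ∑ c ∈ F, b := Finset.sum_le_sum hb
      _ = F.card * b := by simp
  have hcard : (0 : ℝ) < F.card := by exact_mod_cast hF.card_pos
  refine le_of_mul_le_mul_left ?_ hcard
  calc (F.card : ℝ) * (((M : ℝ) - 1) * μ.real B) = μ.real B • (((M : ℝ) - 1) * F.card) := by
        rw [smul_eq_mul]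
        ring
    _ ≤ M * (F.card * b) := h.trans (mul_le_mul_of_nonneg_left h' (Nat.cast_nonneg M))
    _ = F.card * (M * b) := by ring

end Measure

/-! ### The outer measure of a ground model set does not decrease -/

section OuterMeasure

variable {e : Fin 5}

open Classical in
/-- The points `x` such that, if only the conditions above `r` in the next `k` levels of a
fusion tree are considered that do not put `x` into a basic clopen set from `C`, then at some
splitting the number of conditions drops by more than the factor `M`. -/
def badSet {P : Type} [LE P] (C : Name P (List Bool)) (M : ℕ → P → ℕ) (ch : ℕ → P → Finset P) :
    ℕ → ℕ → P → Set (ℕ → Bool)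
  | 0, n, r => {x | ∃ k < n, fMem (restr x k) C r}
  | k + 1, n, r =>
    {x | M n r * {c ∈ ch n r | x ∉ badSet C M ch k (n + 1) c}.card < (ch n r).card}

theorem badSet_zero_eq {P : Type} [LE P] (C : Name P (List Bool)) (M : ℕ → P → ℕ)
    (ch : ℕ → P → Finset P) (n : ℕ) (r : P) :
    badSet C M ch 0 n r = ⋃ s ∈ {s : List Bool | s.length < n ∧ fMem s C r}, cyl s := by
  ext x
  simp only [badSet, mem_iUnion₂]
  constructor
  · rintro ⟨k, hk, h⟩
    exact ⟨restr x k, ⟨by simpa using hk, h⟩, mem_cyl_restr x k⟩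
  · rintro ⟨s, ⟨hs, h⟩, hx⟩
    exact ⟨s.length, hs, by rwa [show restr x s.length = s from hx]⟩

theorem exists_decide {P : Type} [Preorder P] (C : Name P (List Bool)) (W : Finset (List Bool))
    (p : P) : ∃ q, p ≤ q ∧ ∀ s ∈ W, fMem s C q ∨ fNot (fMem s C) q := by
  classical
  induction W using Finset.induction_on with
  | empty => exact ⟨p, le_rfl, by simp⟩
  | insert s W _ ih =>
    obtain ⟨q, hpq, hq⟩ := ih
    obtain ⟨r, hqr, hr⟩ : ∃ r, q ≤ r ∧ (fMem s C r ∨ fNot (fMem s C) r) := by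
      by_cases h : ∃ r, q ≤ r ∧ fMem s C r
      · exact h.imp fun r hr => ⟨hr.1, .inl hr.2⟩
      · exact ⟨q, le_rfl, .inr fun r hr hs => h ⟨r, hr, hs⟩⟩
    refine ⟨r, hpq.trans hqr, fun t ht => ?_⟩
    rcases Finset.mem_insert.1 ht with rfl | ht
    · exact hr
    · exact (hq t ht).imp (fMem_mono hqr) fun h u hu => h u (hqr.trans hu)

/-- Suppose a cover of total size `ρ` is forced. In a fixed fusion tree deciding the cover, the bad
sets have measure below the outer measure of `A`. A point of `A` outside all of them allows pruning
to conditions that do not put it into the cover, at the cost of one unit of the norm per splitting.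
-/
theorem forced_fNot_fOuterLE {A : Set (ℕ → Bool)} {ρ : ℝ≥0} (hA : (ρ : ℝ≥0∞) < cantorMeasure A) :
    Forced (P := LogForcing e) (fNot (fOuterLE A ρ)) := by
  classical
  intro _ p₂ _ hp₂
  obtain ⟨p₁, -, C, hcov, hsum⟩ := hp₂ p₂ le_rfl
  -- the length of the root from which on the losses are negligible
  obtain ⟨L, hL, hL1⟩ : ∃ L : ℕ, ENNReal.ofReal (ρ / (1 - (1 / 2) ^ L)) < cantorMeasure A ∧
      1 ≤ L := by
    have h1 := tendsto_pow_atTop_nhds_zero_of_lt_one (r := (1 / 2 : ℝ)) (by norm_num) (by norm_num)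
    have h2 : Tendsto (fun L : ℕ => ENNReal.ofReal (ρ / (1 - (1 / 2) ^ L))) atTop (𝓝 ρ) := by
      have := ENNReal.tendsto_ofReal ((tendsto_const_nhds (x := (ρ : ℝ))).div (h1.const_sub 1)
        (by norm_num))
      rwa [sub_zero, div_one, ENNReal.ofReal_coe_nnreal] at this
    exact ((h2.eventually_lt_const hA).and (eventually_ge_atTop 1)).exists
  obtain ⟨p, hp₁p, hpL⟩ := p₁.exists_lt_length_root L
  -- The length requirement pushes the next splitting place to at least `L + n`, which makes the
  -- losses there at most `(1 / 2) ^ (L + n + 3)`.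
  let I : ℕ → LogForcing e → Prop := fun n r => p₁ ≤ r ∧ L + n ≤ r.root.length ∧
    ∀ s : List Bool, s.length < n → fMem s C r ∨ fNot (fMem s C) r
  have hIp : I 0 p := ⟨hp₁p, hpL.le, by simp⟩
  -- The exponent is `n + 1` because the later pruning consumes one unit.
  have hex : ∀ n r, I n r → ∃ m F, IsSplit (n + 1) m r F ∧ ∀ c ∈ F, I (n + 1) c := by
    rintro n r ⟨hr, hrl, -⟩
    obtain ⟨m, F, hF, hFD⟩ := exists_isSplit_of_dense r (n + 1)
      fun c _ => exists_decide C (List.finite_length_lt Bool (n + 1)).toFinset c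
    refine ⟨m, F, hF, fun c hc => ⟨hr.trans (hF.le c hc), ?_,
      fun s hs => hFD c hc s (by simpa using Nat.le_of_lt_succ hs)⟩⟩
    have := hF.length_le
    have := hF.lt_length c hc
    omega
  choose! pl ch hsplit hch using hex
  let bad := badSet C (fun n r => growth (pl n r)) ch
  -- If `r` already puts `x` into the cover then so do all its children, and none is left to keep.
  have hmono : ∀ k n r, I n r → bad k n r ⊆ bad (k + 1) n r := by
    intro k
    induction k with
    | zero =>
      rintro n r hr x ⟨k, hk, hx⟩
      have : {c ∈ ch n r | x ∉ bad 0 (n + 1) c} = ∅ := Finset.filter_eq_empty_iff.2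
        fun c hc h => h ⟨k, hk.trans (Nat.lt_succ_self n), fMem_mono ((hsplit n r hr).le c hc) hx⟩
      change growth (pl n r) * {c ∈ ch n r | x ∉ bad 0 (n + 1) c}.card < (ch n r).card
      rw [this, Finset.card_empty, mul_zero]
      exact (hsplit n r hr).nonempty.card_pos
    | succ k ih =>
      intro n r hr x hx
      refine lt_of_le_of_lt (Nat.mul_le_mul_left _ (Finset.card_le_card fun c hc => ?_)) hx
      rw [Finset.mem_filter] at hc ⊢
      exact ⟨hc.1, fun h => hc.2 (ih (n + 1) c (hch n r hr c hc.1) h)⟩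
  -- The bound absorbs all factors `M / (M - 1)` from higher levels, and so does not depend on the
  -- depth `k`.
  have hbound : ∀ k n r, I n r → MeasurableSet (bad k n r) ∧
      cantorMeasure.real (bad k n r) ≤ ρ / (1 - (1 / 2) ^ (L + n)) := by
    intro k
    induction k with
    | zero =>
      intro n r hr
      have hzero : bad 0 n r = ⋃ s ∈ {s : List Bool | s.length < n ∧ fMem s C r}, cyl s :=
        badSet_zero_eq C _ ch n r
      have hfin : {s : List Bool | s.length < n ∧ fMem s C r}.Finite :=
        (List.finite_length_lt Bool n).subset fun s hs => hs.1
      rw [hzero]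
      refine ⟨hfin.measurableSet_biUnion fun s _ => measurableSet_cyl s, ?_⟩
      have hρ : cantorMeasure (⋃ s ∈ {s : List Bool | s.length < n ∧ fMem s C r}, cyl s) ≤ ρ := by
        have h1 := hsum hfin.toFinset r hr.1 fun s => (hfin.mem_toFinset.1 s.2).2
        calc cantorMeasure (⋃ s ∈ {s : List Bool | s.length < n ∧ fMem s C r}, cyl s)
            = cantorMeasure (⋃ s ∈ hfin.toFinset, cyl s) := by simp
          _ ≤ ∑ s ∈ hfin.toFinset, cantorMeasure (cyl s) := measure_biUnion_finset_le _ _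
          _ = ((∑ s ∈ hfin.toFinset, (1 / 2 : ℝ≥0) ^ s.length : ℝ≥0) : ℝ≥0∞) := by
            simp only [cantorMeasure_cyl, ENNReal.ofNNReal_finsetSum]
          _ ≤ ρ := ENNReal.coe_le_coe.2 h1
      have hρ' := ENNReal.toReal_mono ENNReal.coe_ne_top hρ
      rw [ENNReal.coe_toReal] at hρ'
      have h2 : (1 / 2 : ℝ) ^ (L + n) < 1 :=
        pow_lt_one₀ (by norm_num) (by norm_num) (by omega)
      have h3 : (0 : ℝ) < (1 / 2) ^ (L + n) := by positivity
      refine hρ'.trans ?_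
      rw [le_div_iff₀ (by linarith)]
      exact mul_le_of_le_one_right ρ.2 (by linarith)
    | succ k ih =>
      intro n r hr
      have hs := hsplit n r hr
      obtain ⟨hm, hle⟩ := measureReal_few_le cantorMeasure (ch n r) hs.nonempty
        (bad k (n + 1)) (fun c hc => (ih (n + 1) c (hch n r hr c hc)).1) (growth (pl n r))
        _ fun c hc => (ih (n + 1) c (hch n r hr c hc)).2
      refine ⟨hm, ?_⟩
      change ((growth (pl n r) : ℝ) - 1) * cantorMeasure.real (bad (k + 1) n r) ≤ _ at hle
      set y := cantorMeasure.real (bad (k + 1) n r) with hy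
      have hy0 : 0 ≤ y := measureReal_nonneg
      have hMpos : (0 : ℝ) < growth (pl n r) := by
        exact_mod_cast zero_lt_one.trans (one_lt_growth _)
      set ε : ℝ := (1 / 2) ^ (L + n) with hε
      have hε0 : 0 < ε := by positivity
      have hε1 : ε < 1 := pow_lt_one₀ (by norm_num) (by norm_num) (by omega)
      have hδ : 1 / (growth (pl n r) : ℝ) ≤ ε / 8 := by
        have h1 : L + n ≤ pl n r := hr.2.1.trans hs.length_le
        calc 1 / (growth (pl n r) : ℝ) = (1 / 2) ^ (pl n r + 3) := by
              rw [growth, Nat.cast_pow, Nat.cast_ofNat, ← one_div_pow]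
          _ ≤ (1 / 2) ^ (L + n + 3) :=
            pow_le_pow_of_le_one (by norm_num) (by norm_num) (by omega)
          _ = ε / 8 := by
            rw [pow_add, ← hε]
            norm_num
            ring
      have hδ0 : 0 < 1 / (growth (pl n r) : ℝ) := by positivity
      set δ := 1 / (growth (pl n r) : ℝ) with hδdef
      have hMδ : (growth (pl n r) : ℝ) * δ = 1 := by
        rw [hδdef]
        field_simp
      have hε' : (1 / 2 : ℝ) ^ (L + (n + 1)) = ε / 2 := by
        rw [hε, ← add_assoc, pow_succ]
        ring
      rw [hε'] at hle
      have hc' : 0 < 1 - ε / 2 := by linarith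
      have h1 : (1 - δ) * y ≤ ρ / (1 - ε / 2) := by
        refine le_of_mul_le_mul_left ?_ hMpos
        calc (growth (pl n r) : ℝ) * ((1 - δ) * y)
            = (growth (pl n r) - growth (pl n r) * δ) * y := by ring
          _ ≤ _ := by
            rw [hMδ]
            exact hle
      rw [le_div_iff₀ hc'] at h1
      rw [le_div_iff₀ (by linarith)]
      -- The induction closes since `δ + ε / 2 ≤ ε`, with room to spare as `δ ≤ ε / 8`.
      have h2 : 1 - ε ≤ (1 - δ) * (1 - ε / 2) := by nlinarith
      calc y * (1 - ε) ≤ y * ((1 - δ) * (1 - ε / 2)) := mul_le_mul_of_nonneg_left h2 hy0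
        _ = (1 - δ) * y * (1 - ε / 2) := by ring
        _ ≤ ρ := h1
  have hmono' : ∀ n r, I n r → Monotone fun k => bad k n r := fun n r hr =>
    monotone_nat_of_le_succ fun k => hmono k n r hr
  obtain ⟨x, hxA, hx⟩ : ∃ x ∈ A, ∀ k, x ∉ bad k 0 p := by
    by_contra! h
    refine absurd hL (not_lt.2 ?_)
    calc cantorMeasure A ≤ cantorMeasure (⋃ k, bad k 0 p) :=
          measure_mono fun x hx => mem_iUnion.2 (h x hx)
      _ = ⨆ k, cantorMeasure (bad k 0 p) := (hmono' 0 p hIp).measure_iUnion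
      _ ≤ ENNReal.ofReal (ρ / (1 - (1 / 2) ^ L)) := iSup_le fun k => by
        have := (hbound k 0 p hIp).2
        rw [add_zero] at this
        rw [← ofReal_measureReal]
        exact ENNReal.ofReal_le_ofReal this
  obtain ⟨q, hpq, -, G, hG, hpre⟩ := fusion (fun n r => I n r ∧ ∀ k, x ∉ bad k n r) (p := p)
    ⟨hIp, hx⟩ (by
      rintro n r ⟨hr, hxr⟩
      -- Finitely many children and increasing bad sets: one depth `K` detects every child that is
      -- bad at some depth. Then `x` not being bad for `r` at depth `K + 1` says that enough
      -- children are good at all depths.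
      have hstab : ∃ K, ∀ c ∈ ch n r, x ∉ bad K (n + 1) c → ∀ k, x ∉ bad k (n + 1) c := by
        have : ∀ c, ∃ K, (∃ k, x ∈ bad k (n + 1) c) → x ∈ bad K (n + 1) c := fun c => by
          by_cases h : ∃ k, x ∈ bad k (n + 1) c
          · exact h.imp fun k hk _ => hk
          · exact ⟨0, fun h' => absurd h' h⟩
        choose K hK using this
        refine ⟨(ch n r).sup K, fun c hc h k hk => h ?_⟩
        exact hmono' (n + 1) c (hch n r hr c hc) (Finset.le_sup hc) (hK c ⟨k, hk⟩)
      obtain ⟨K, hK⟩ := hstab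
      refine ⟨_, {c ∈ ch n r | ∀ k, x ∉ bad k (n + 1) c},
        (hsplit n r hr).subset (Finset.filter_subset _ _) ?_, fun c hc => ?_⟩
      · refine (not_lt.1 (hxr (K + 1))).trans (Nat.mul_le_mul_left _ (Finset.card_le_card ?_))
        intro c hc
        rw [Finset.mem_filter] at hc ⊢
        exact ⟨hc.1, hK c hc.1 hc.2⟩
      · rw [Finset.mem_filter] at hc
        exact ⟨hch n r hr c hc.1, hc.2⟩)
  obtain ⟨q', hqq', k, hk⟩ := hcov ⟨x, hxA⟩ q (hp₁p.trans hpq)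
  obtain ⟨r, hr, u, hru, hqu⟩ := hpre (k + 1) q' hqq'
  obtain ⟨⟨-, -, hdec⟩, hxr⟩ := hG (k + 1) r hr
  -- Level `k + 1` decides sequences of length `k`: a positive decision puts `x` into the bad set of
  -- depth `0`, a negative one contradicts `q'`.
  rcases hdec (restr x k) (by simp) with h | h
  · exact hxr 0 ⟨k, Nat.lt_succ_self k, h⟩
  · exact h u hru (fMem_mono hqu hk)

theorem preservesOuterMeasure_log : PreservesOuterMeasure (LogForcing e) :=
  fun _ _ => ⟨forced_fOuterLE, forced_fNot_fOuterLE⟩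

end OuterMeasure

end Creature

open Creature in
theorem mainTheorem1 :
    ∃ (D : Type) (H : ℕ → Set ℕ) (K : Set (WeakCreature ℕ D))
      (Sig : Set (WeakCreature ℕ D) → Set (WeakCreature ℕ D)),
      IsTreeCreatingPair H K Sig ∧
      StronglyFinitary H K Sig ∧
      IsBig 2 K Sig ∧
      TOmittory H K Sig ∧
      Gluing H K Sig ∧
      NNPType H K Sig ∧
      StronglyViolatesSacks H K Sig ∧
      (∀ e e' : Fin 5,
        ForcingEquivalent (TreeForcing H K Sig e) (TreeForcing H K Sig e')) ∧
      ∀ e : Fin 5,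
        (∀ p : TreeForcing H K Sig e, p ≤ p) ∧
        (∀ p q r : TreeForcing H K Sig e, p ≤ q → q ≤ r → p ≤ r) ∧
        IsProper (TreeForcing H K Sig e) ∧
        BaireBounding (TreeForcing H K Sig e) ∧
        PreservesOuterMeasure (TreeForcing H K Sig e) ∧
        PreservesNonMeager (TreeForcing H K Sig e) ∧
        ¬ SacksProperty (TreeForcing H K Sig e) := by
  exact ⟨Unit, alphabet, logCreatures, logSig, isTreeCreatingPair_log, stronglyFinitary_log, isBig_log,
    tOmittory_log, gluing_log, nnpType_log, stronglyViolatesSacks_log, forcingEquivalent_log,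
    fun _ => ⟨TreeForcing.refl, fun _ _ _ => TreeForcing.trans, isProper_log, baireBounding_log,
      preservesOuterMeasure_log, preservesNonMeager_log, not_sacksProperty_log⟩⟩
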